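/- Let $\mathcal D$ be a probability distribution, let $f(\cdot,\xi):\mathbb R^d\to\mathbb R$ be differentiable for every sample $\xi$, let $F(x)=\mathbb E_{\xi\sim\mathcal D}[f(x,\xi)]$ be differentiable, and let $\sigma,\beta,\widehat G\ge 0$. Write $\|\cdot\|$ for the Euclidean norm and $\nabla f(x,\xi)$ for the gradient in $x$. Assume: 1. $F^*:=\inf_{x\in\mathbb R^d}F(x)>-\infty$; 2. $\mathbb E_\xi[\nabla f(x,\xi)]=\nabla F(x)$ and $\mathbb E_\xi[\|\nabla f(x,\xi)-\nabla F(x)\|^2]\le\sigma^2$ for all $x$; 3. $\mathbb E_\xi[\|\nabla f(x,\xi)-\nabla f(y,\xi)\|^2]\le\beta^2\|x-y\|^2$ for all $x,y$; 4. for almost every $\xi\sim\mathcal D$, $\|\nabla f(x,\xi)\|\le\widehat G$ for all $x$. Consider the algorithm META-STORM-SG with $p=\tfrac12$, $q=\tfrac14$ and $a_0=b_0=\eta=1$. Given $x_1\in\mathbb R^d$ and independent samples $\xi_1,\xi_2,\dots\sim\mathcal D$, put $d_1=\nabla f(x_1,\xi_1)$ and, for $t=1,2,\dots,T$, $$a_{t+1}=\Big(1+\sum_{i=1}^t\|\nabla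 f(x_i,\xi_i)\|^2\Big)^{-2/3},\qquad b_t=\Big(1+\sum_{i=1}^t\|d_i\|^2\Big)^{1/2}\Big/a_{t+1}^{1/4},\qquad x_{t+1}=x_t-\frac{1}{b_t}d_t,$$ $$d_{t+1}=\nabla f(x_{t+1},\xi_{t+1})+(1-a_{t+1})\big(d_t-\nabla f(x_t,\xi_{t+1})\big).$$ The output is $x_{\rm out}=x_t$, where $t$ is uniform on $\{1,\dots,T\}$ and independent of the samples. Let $\beta_{\max}=\max\{\beta,1\}$. There are absolute constants $C,C_1,C_2,C_3>0$ (independent of $d,\mathcal D,f,\sigma,\beta,\widehat G,x_1,T$) such that for every $T\ge1$ $$\mathbb E\big[\|\nabla F(x_{\rm out})\|^{2/3}\big]\le C\left(\frac{W_1\,\mathbf 1\big[(\sigma^2T)^{1/3}\le W_1\big]}{T^{1/3}}+\Big(W_2+W_3\log^{2/3}(1+\sigma^2T)\Big)\Big(\frac1{T^{1/3}}+\frac{\sigma^{2/9}}{T^{2/9}}\Big)\right),$$ where $$W_1=C_1\Big(F(x_1)-F^*+\sigma^2+\widehat G^2+\beta_{\max}(1+\widehat G^2)\log\big(\beta_{\max}+\widehat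 G^2\beta_{\max}\big)\Big),$$ $$W_2=C_2\Big(1+(F(x_1)-F^*)^{2/3}+\sigma^{4/3}+\widehat G^{4/3}+(1+\widehat G^{4/3})\beta_{\max}^{2/3}\log^{2/3}\big(\beta_{\max}+\widehat G^2\beta_{\max}\big)\Big),$$ $$W_3=C_3(1+\widehat G^{4/3})\beta_{\max}^{2/3}.$$ -/

import Mathlib

open MeasureTheory ProbabilityTheory

noncomputable section

namespace MetaStorm

variable {d : ℕ} {Ξ : Type*}

/-- The objective `F(x) = E_{ξ ∼ D} [f(x, ξ)]`. -/
def objective [MeasurableSpace Ξ] (D : Measure Ξ)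
    (f : EuclideanSpace ℝ (Fin d) → Ξ → ℝ) (x : EuclideanSpace ℝ (Fin d)) : ℝ :=
  ∫ ξ, f x ξ ∂D

/-- The stochastic gradient `∇f(x, ξ)`, the gradient being taken in `x`. -/
def stochGrad (f : EuclideanSpace ℝ (Fin d) → Ξ → ℝ)
    (x : EuclideanSpace ℝ (Fin d)) (ξ : Ξ) : EuclideanSpace ℝ (Fin d) :=
  gradient (fun y => f y ξ) x

/-- The standing setting: every `f(·, ξ)` is differentiable, every `f(x, ·)` is measurable and
integrable, so that `F` is the expectation of `f`, and `F` is differentiable. -/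
structure IsSamplingFunction [MeasurableSpace Ξ] (D : Measure Ξ)
    (f : EuclideanSpace ℝ (Fin d) → Ξ → ℝ) : Prop where
  differentiable_sample : ∀ ξ, Differentiable ℝ (fun x => f x ξ)
  measurable_sample : ∀ x, Measurable (f x)
  integrable_sample : ∀ x, Integrable (f x) D
  differentiable_objective : Differentiable ℝ (objective D f)

/-- Assumption 1: the objective is bounded from below. -/
def LowerBounded [MeasurableSpace Ξ] (D : Measure Ξ)
    (f : EuclideanSpace ℝ (Fin d) → Ξ → ℝ) : Prop :=
  BddBelow (Set.range (objective D f))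

/-- Assumption 2: the stochastic gradient is unbiased, with variance at most `σ²`. -/
def UnbiasedBoundedVariance [MeasurableSpace Ξ] (D : Measure Ξ)
    (f : EuclideanSpace ℝ (Fin d) → Ξ → ℝ) (σ : ℝ) : Prop :=
  ∀ x, Integrable (stochGrad f x) D ∧
    ∫ ξ, stochGrad f x ξ ∂D = gradient (objective D f) x ∧
    Integrable (fun ξ => ‖stochGrad f x ξ - gradient (objective D f) x‖ ^ 2) D ∧
    ∫ ξ, ‖stochGrad f x ξ - gradient (objective D f) x‖ ^ 2 ∂D ≤ σ ^ 2

/-- Assumption 3: averaged `β`-smoothness. -/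
def AveragedSmooth [MeasurableSpace Ξ] (D : Measure Ξ)
    (f : EuclideanSpace ℝ (Fin d) → Ξ → ℝ) (β : ℝ) : Prop :=
  ∀ x y, Integrable (fun ξ => ‖stochGrad f x ξ - stochGrad f y ξ‖ ^ 2) D ∧
    ∫ ξ, ‖stochGrad f x ξ - stochGrad f y ξ‖ ^ 2 ∂D ≤ β ^ 2 * ‖x - y‖ ^ 2

/-- Assumption 4: the stochastic gradients are bounded by `G`, for almost every sample. -/
def BoundedStochGrad [MeasurableSpace Ξ] (D : Measure Ξ)
    (f : EuclideanSpace ℝ (Fin d) → Ξ → ℝ) (G : ℝ) : Prop :=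
  ∀ᵐ ξ ∂D, ∀ x, ‖stochGrad f x ξ‖ ≤ G

/-- The state of META-STORM-SG at time `t`: the iterate `x_t`, the direction `d_t`, and the two
running sums `∑_{i ≤ t} ‖∇f(x_i, ξ_i)‖²` and `∑_{i ≤ t} ‖d_i‖²`. -/
structure State (d : ℕ) where
  x : EuclideanSpace ℝ (Fin d)
  dir : EuclideanSpace ℝ (Fin d)
  gradSum : ℝ
  dirSum : ℝ

/-- The momentum parameter `a_{t+1} = (1 + ∑_{i ≤ t} ‖∇f(x_i, ξ_i)‖² / a₀²)^(-2/3)`, read off from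
the state at time `t`. -/
def momentum (a₀ : ℝ) (s : State d) : ℝ :=
  (1 + s.gradSum / a₀ ^ 2) ^ (-(2 / 3) : ℝ)

/-- The scaling `b_t = (b₀^(1/p) + ∑_{i ≤ t} ‖d_i‖²)^p / a_{t+1}^q` with `p + 2 q = 1`. -/
def stepScale (a₀ b₀ p : ℝ) (s : State d) : ℝ :=
  (b₀ ^ (1 / p) + s.dirSum) ^ p / momentum a₀ s ^ ((1 - p) / 2)

/-- The state at time `1`: `d_1 = ∇f(x_1, ξ_1)`. -/
def initState (f : EuclideanSpace ℝ (Fin d) → Ξ → ℝ)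
    (x₁ : EuclideanSpace ℝ (Fin d)) (ξ : Ξ) : State d where
  x := x₁
  dir := stochGrad f x₁ ξ
  gradSum := ‖stochGrad f x₁ ξ‖ ^ 2
  dirSum := ‖stochGrad f x₁ ξ‖ ^ 2

/-- The next iterate `x_{t+1} = x_t - (η / b_t) d_t`. -/
def nextPoint (a₀ b₀ η p : ℝ) (s : State d) : EuclideanSpace ℝ (Fin d) :=
  s.x - (η / stepScale a₀ b₀ p s) • s.dir

/-- The next direction
`d_{t+1} = ∇f(x_{t+1}, ξ_{t+1}) + (1 - a_{t+1}) (d_t - ∇f(x_t, ξ_{t+1}))`. -/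
def nextDir (a₀ b₀ η p : ℝ) (f : EuclideanSpace ℝ (Fin d) → Ξ → ℝ) (s : State d) (ξ : Ξ) :
    EuclideanSpace ℝ (Fin d) :=
  stochGrad f (nextPoint a₀ b₀ η p s) ξ +
    (1 - momentum a₀ s) • (s.dir - stochGrad f s.x ξ)

/-- One iteration of META-STORM-SG, with the fresh sample `ξ = ξ_{t+1}`. -/
def step (a₀ b₀ η p : ℝ) (f : EuclideanSpace ℝ (Fin d) → Ξ → ℝ) (s : State d) (ξ : Ξ) :
    State d where
  x := nextPoint a₀ b₀ η p s
  dir := nextDir a₀ b₀ η p f s ξ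
  gradSum := s.gradSum + ‖stochGrad f (nextPoint a₀ b₀ η p s) ξ‖ ^ 2
  dirSum := s.dirSum + ‖nextDir a₀ b₀ η p f s ξ‖ ^ 2

/-- The states of META-STORM-SG at the times `t = 1, 2, …`, run on the samples `ξ_1, ξ_2, …`
(the value at `t = 0` and the sample `ξ_0` play no role). -/
def state (a₀ b₀ η p : ℝ) (f : EuclideanSpace ℝ (Fin d) → Ξ → ℝ)
    (x₁ : EuclideanSpace ℝ (Fin d)) (ξ : ℕ → Ξ) : ℕ → State d
  | 0 => initState f x₁ (ξ 1)
  | 1 => initState f x₁ (ξ 1)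
  | t + 2 => step a₀ b₀ η p f (state a₀ b₀ η p f x₁ ξ (t + 1)) (ξ (t + 2))

/-- The iterate `x_t` of META-STORM-SG, `t ≥ 1`. -/
def iterate (a₀ b₀ η p : ℝ) (f : EuclideanSpace ℝ (Fin d) → Ξ → ℝ)
    (x₁ : EuclideanSpace ℝ (Fin d)) (ξ : ℕ → Ξ) (t : ℕ) : EuclideanSpace ℝ (Fin d) :=
  (state a₀ b₀ η p f x₁ ξ t).x

/-- `β_max = max {β, 1}`. -/
def betaMax (β : ℝ) : ℝ := max β 1

/-- The order of `W₁`, where `Δ` stands for `F(x₁) - F*`. -/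
def orderW₁ (Δ σ G β : ℝ) : ℝ :=
  Δ + σ ^ 2 + G ^ 2 + betaMax β * (1 + G ^ 2) * Real.log (betaMax β + G ^ 2 * betaMax β)

/-- The order of `W₂`, where `Δ` stands for `F(x₁) - F*`. -/
def orderW₂ (Δ σ G β : ℝ) : ℝ :=
  1 + Δ ^ (2 / 3 : ℝ) + σ ^ (4 / 3 : ℝ) + G ^ (4 / 3 : ℝ) +
    (1 + G ^ (4 / 3 : ℝ)) * betaMax β ^ (2 / 3 : ℝ) *
      Real.log (betaMax β + G ^ 2 * betaMax β) ^ (2 / 3 : ℝ)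

/-- The order of `W₃`. -/
def orderW₃ (G β : ℝ) : ℝ :=
  (1 + G ^ (4 / 3 : ℝ)) * betaMax β ^ (2 / 3 : ℝ)

/-- The convergence rate
`W₁ 1[(σ²T)^(1/3) ≤ W₁] / T^(1/3) + (W₂ + W₃ log^(2/3)(1 + σ²T)) (T^(-1/3) + σ^(2/9) T^(-2/9))`. -/
def rate (W₁ W₂ W₃ σ : ℝ) (T : ℕ) : ℝ :=
  W₁ * Set.indicator {w : ℝ | (σ ^ 2 * T) ^ (1 / 3 : ℝ) ≤ w} 1 W₁ / (T : ℝ) ^ (1 / 3 : ℝ) +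
    (W₂ + W₃ * Real.log (1 + σ ^ 2 * T) ^ (2 / 3 : ℝ)) *
      (1 / (T : ℝ) ^ (1 / 3 : ℝ) + σ ^ (2 / 9 : ℝ) / (T : ℝ) ^ (2 / 9 : ℝ))

end MetaStorm

end

/-! Write Γ_t = ∑_{i ≤ t} ‖∇f(x_i, ξ_i)‖², D_t = ∑_{i ≤ t} ‖d_i‖², u_t = (1 + Γ_t)^(1/3) and ε_t =
d_t - ∇F(x_t). Then a_{t+1} = u_t^(-2) and b_t² = (1 + D_t) u_t.

Error. Conditionally on the past, ‖ε‖² contracts by the factor 1 - u_t^(-2), up to a smoothness term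
and a noise term. Weighted by u_t it therefore releases ‖ε_t‖² / u_t at each step. The next weight
depends on the fresh sample, but u_{t+1} ≤ u_t + G² / (3 u_t²), and adding the constant G²/3 to the
weight pays for this growth. The remaining terms telescope into logarithms, so E := ∑ ‖ε_t‖² / u_t
has mean at most of order (1 + G²)(σ² + G² + β² E[log(1 + D_T)] + E[log(1 + Γ_T)]): see
`integral_potential_step_le` and `integral_sum_err_sq_run_le`.

Pathwise bounds. The descent lemma controls D_T / b_T by F(x₁) - F*, E and log(1 + D_T)
(`dirSum_div_stepScale_run_le`). The sum H of the squared gradients of F satisfies H ≤ 2 D_T + 2 u_T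
E, and Γ_T ≤ 2 H + 2 N, where the noise sum N has mean at most σ²T = S³.

Closing the loop. These bounds contain products of dependent random variables, so they are closed at
the level of cube roots: AM-GM with deterministic weights splits the products, and tangent lines of
the logarithm replace Jensen. For m = E[H^(1/3)] + E[(1 + D_T)^(1/3)] this gives, with a free
parameter l > 0, the inequality m ≲ l (A + K log(1 + m + S)) + (1 + m + S) / l²
(`selfBound_of_moments`), where K = β_max (1 + G²) and A is one plus the order of W₁. If m ≥ 1 + S,
a fixed l absorbs m and yields m ≲ A, which is the indicator term up to a part absorbed by W₂;
otherwise the optimal l yields the other terms of the rate (`le_rate_of_selfBound`). Concavity of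
the cube root passes from H to the uniformly chosen iterate. -/

noncomputable section

namespace MetaStorm

/-! ### Cube roots, and the resolution of the self-bounding inequality -/

section

theorem rpow_third_pow {x : ℝ} (hx : 0 ≤ x) : (x ^ (1 / 3 : ℝ)) ^ 3 = x := by
  rw [← Real.rpow_natCast, ← Real.rpow_mul hx]; norm_num

theorem rpow_two_thirds {x : ℝ} (hx : 0 ≤ x) : x ^ (2 / 3 : ℝ) = (x ^ (1 / 3 : ℝ)) ^ 2 := by
  rw [← Real.rpow_natCast, ← Real.rpow_mul hx]; norm_num

/-- AM-GM for three numbers. It splits products of dependent random quantities into sums whose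
expectations are available, in place of Hölder's inequality. -/
theorem three_mul_le_of_cube_le {x y z w : ℝ} (hx : 0 ≤ x) (hy : 0 ≤ y) (hz : 0 ≤ z)
    (h : w ^ 3 ≤ x * y * z) : 3 * w ≤ x + y + z := by
  have key : 27 * (x * y * z) ≤ (x + y + z) ^ 3 := by
    nlinarith [mul_nonneg hx (sq_nonneg (y - z)), mul_nonneg hy (sq_nonneg (x - z)),
      mul_nonneg hz (sq_nonneg (x - y)), mul_nonneg hx (sq_nonneg (x - y)),
      mul_nonneg hx (sq_nonneg (x - z)), mul_nonneg hy (sq_nonneg (y - z)),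
      mul_nonneg hy (sq_nonneg (x - y)), mul_nonneg hz (sq_nonneg (x - z)),
      mul_nonneg hz (sq_nonneg (y - z))]
  have h3 : (3 * w) ^ 3 ≤ (x + y + z) ^ 3 := by nlinarith
  exact le_of_pow_le_pow_left₀ (by norm_num) (by positivity) h3

/-- Past `K = 3` the logarithm is at least 1. This lets terms linear in `K` be charged to `A`,
although W₁ is only known to contain `K log K`. -/
theorem le_three_mul_of_mul_log_le {K A : ℝ} (hK : 1 ≤ K) (hA : 1 ≤ A) (h : K * Real.log K + 1 ≤ A) :
    K ≤ 3 * A := by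
  rcases le_total K 3 with h3 | h3
  · linarith
  · have : 1 ≤ Real.log K := by
      rw [Real.le_log_iff_exp_le (by linarith)]
      linarith [Real.exp_one_lt_d9]
    nlinarith

/-- Resolving the self-bounding inequality when the noise `S` is dominated. -/
theorem selfBound_large {A K m S : ℝ} (hA : 1 ≤ A) (hK : 1 ≤ K) (hKA : K * Real.log K + 1 ≤ A)
    (hS : 0 ≤ S) (hm : 1 + S ≤ m)
    (h : ∀ l : ℝ, 0 < l → m ≤ 476 * l * (A + K * Real.log (1 + m + S)) + 8 * (1 + m + S) / l ^ 2) :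
    m ≤ 10 ^ 10 * A := by
  have hK3 := le_three_mul_of_mul_log_le hK hA hKA
  -- For `l = 8` the last term is `(1 + m + S) / 8 ≤ m / 4`, which the left side absorbs.
  have h8 := h 8 (by norm_num)
  have hK0 : 0 < K := by linarith
  -- A tangent line of the logarithm at `40000 K`: after multiplication by `476 * 8 * K` its slope
  -- is below 1/10, so this part is absorbed by `m` as well.
  have hlog : Real.log (1 + m + S) ≤ (1 + m + S) / (40000 * K) + 40000 + Real.log K := by
    have h1 : 1 + m + S = (1 + m + S) / (40000 * K) * (40000 * K) := by field_simp
    have hp : 0 < (1 + m + S) / (40000 * K) := by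
      apply div_pos <;> linarith
    have h2 : Real.log (1 + m + S) =
        Real.log ((1 + m + S) / (40000 * K)) + (Real.log 40000 + Real.log K) := by
      rw [← Real.log_mul (by norm_num) (by linarith), ← Real.log_mul (by linarith)
        (by positivity), ← h1]
    have h3 := Real.log_le_sub_one_of_pos hp
    have h4 := Real.log_le_sub_one_of_pos (show (0:ℝ) < 40000 by norm_num)
    linarith
  have h5 : K * Real.log (1 + m + S) ≤
      (1 + m + S) / 40000 + 40000 * K + K * Real.log K := by
    have := mul_le_mul_of_nonneg_left hlog hK0.le
    have e : K * ((1 + m + S) / (40000 * K) + 40000 + Real.log K) =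
      (1 + m + S) / 40000 + 40000 * K + K * Real.log K := by field_simp
    linarith
  norm_num at h8
  linarith

/-- Resolving the self-bounding inequality when the noise `S` dominates. -/
theorem selfBound_small {A K m S : ℝ} (hA : 1 ≤ A) (hK : 1 ≤ K)
    (hS : 0 ≤ S) (hm0 : 0 ≤ m) (hm : m ≤ 1 + S)
    (h : ∀ l : ℝ, 0 < l → m ≤ 476 * l * (A + K * Real.log (1 + m + S)) + 8 * (1 + m + S) / l ^ 2) :
    m ≤ 492 * ((A + K * Real.log (2 * (1 + S))) ^ (2 / 3 : ℝ) * (1 + S) ^ (1 / 3 : ℝ)) := by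
  set V := A + K * Real.log (2 * (1 + S)) with hV
  have hlog : Real.log (1 + m + S) ≤ Real.log (2 * (1 + S)) :=
    Real.log_le_log (by linarith) (by linarith)
  have hl0 : 0 ≤ Real.log (2 * (1 + S)) := Real.log_nonneg (by linarith)
  have hV1 : 1 ≤ V := by nlinarith
  have hV0 : 0 < V := by linarith
  set v := V ^ (1 / 3 : ℝ) with hv
  set s := (1 + S) ^ (1 / 3 : ℝ) with hs
  have hvp : 0 < v := by positivity
  have hsp : 0 < s := by positivity
  have hv3 : v ^ 3 = V := rpow_third_pow hV0.le
  have hs3 : s ^ 3 = 1 + S := rpow_third_pow (by linarith)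
  rw [rpow_two_thirds hV0.le, ← hv]
  -- This `l` balances the two terms: both become multiples of `v² s`.
  have h1 := h (s / v) (by positivity)
  have h2 : 476 * (s / v) * (A + K * Real.log (1 + m + S)) ≤ 476 * (s / v) * v ^ 3 := by
    rw [hv3]
    apply mul_le_mul_of_nonneg_left _ (by positivity)
    have := mul_le_mul_of_nonneg_left hlog (by linarith : 0 ≤ K)
    linarith
  have h3 : 8 * (1 + m + S) / (s / v) ^ 2 ≤ 8 * (2 * s ^ 3) / (s / v) ^ 2 := by
    rw [hs3]
    gcongr
    linarith
  have e1 : 476 * (s / v) * v ^ 3 = 476 * (v ^ 2 * s) := by field_simp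
  have e2 : 8 * (2 * s ^ 3) / (s / v) ^ 2 = 16 * (v ^ 2 * s) := by field_simp; norm_num
  linarith

/-- From the self-bounding inequality to the rate. -/
theorem le_rate_of_selfBound {Δ σ β G m : ℝ} {T : ℕ} (hΔ : 0 ≤ Δ) (hσ : 0 ≤ σ)
    (hG : 0 ≤ G) (hT : 1 ≤ T) (hm0 : 0 ≤ m)
    (h : ∀ l : ℝ, 0 < l → m ≤ 476 * l * (1 + orderW₁ Δ σ G β + betaMax β * (1 + G ^ 2) *
      Real.log (1 + m + (σ ^ 2 * T) ^ (1 / 3 : ℝ))) +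
        8 * (1 + m + (σ ^ 2 * T) ^ (1 / 3 : ℝ)) / l ^ 2) :
    m / (T : ℝ) ^ (1 / 3 : ℝ) ≤ 10 ^ 5 * rate (2 * 10 ^ 10 * orderW₁ Δ σ G β)
      (2 * 10 ^ 10 * orderW₂ Δ σ G β) (1 * orderW₃ G β) σ T := by
  set S := (σ ^ 2 * T) ^ (1 / 3 : ℝ) with hSdef
  set K := betaMax β * (1 + G ^ 2) with hKdef
  have hb1 : 1 ≤ betaMax β := le_max_right _ _
  have hK : 1 ≤ K := by nlinarith [sq_nonneg G]
  have hKlog : 0 ≤ Real.log K := Real.log_nonneg hK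
  have hK' : betaMax β + G ^ 2 * betaMax β = K := by rw [hKdef]; ring
  have hW1 : orderW₁ Δ σ G β = Δ + σ ^ 2 + G ^ 2 + K * Real.log K := by
    rw [orderW₁, hK']
  set A := 1 + orderW₁ Δ σ G β with hA
  have hKl0 : 0 ≤ K * Real.log K := by positivity
  have hKA : K * Real.log K + 1 ≤ A := by rw [hA, hW1]; nlinarith [sq_nonneg σ, sq_nonneg G]
  have hA1 : 1 ≤ A := by linarith
  have hW10 : 0 ≤ orderW₁ Δ σ G β := by linarith
  have hS : 0 ≤ S := by positivity
  have hT0 : (0:ℝ) < T := by exact_mod_cast hT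
  have hTp : 0 < (T : ℝ) ^ (1 / 3 : ℝ) := by positivity
  have hlogK0 : 0 ≤ Real.log K ^ (2 / 3 : ℝ) := by positivity
  have hW2 : 1 ≤ orderW₂ Δ σ G β := by
    rw [orderW₂, hK']
    have : 0 ≤ Δ ^ (2 / 3 : ℝ) + σ ^ (4 / 3 : ℝ) + G ^ (4 / 3 : ℝ) +
      (1 + G ^ (4 / 3 : ℝ)) * betaMax β ^ (2 / 3 : ℝ) * Real.log K ^ (2 / 3 : ℝ) := by positivity
    linarith
  have hW3 : 0 ≤ orderW₃ G β := by rw [orderW₃]; positivity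
  have hz : 0 ≤ σ ^ 2 * T := by positivity
  have hlogz : 0 ≤ Real.log (1 + σ ^ 2 * T) := Real.log_nonneg (by linarith)
  set ℓ := Real.log (1 + σ ^ 2 * T) ^ (2 / 3 : ℝ) with hℓ
  have hℓ0 : 0 ≤ ℓ := by positivity
  have hind : 0 ≤ 2 * 10 ^ 10 * orderW₁ Δ σ G β * Set.indicator {w : ℝ | S ≤ w} 1
      (2 * 10 ^ 10 * orderW₁ Δ σ G β) / (T : ℝ) ^ (1 / 3 : ℝ) := by
    apply div_nonneg _ hTp.le
    apply mul_nonneg (by positivity)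
    apply Set.indicator_nonneg
    intro _ _; exact zero_le_one
  have hσT : 0 ≤ σ ^ (2 / 9 : ℝ) / (T : ℝ) ^ (2 / 9 : ℝ) := by positivity
  have hσT' : σ ^ (2 / 9 : ℝ) / (T : ℝ) ^ (2 / 9 : ℝ) = S ^ (1 / 3 : ℝ) / (T : ℝ) ^ (1 / 3 : ℝ) := by
    rw [hSdef, ← Real.rpow_mul hz, Real.mul_rpow (by positivity) hT0.le, ← Real.rpow_natCast,
      ← Real.rpow_mul hσ, mul_div_assoc, ← Real.rpow_sub hT0, div_eq_mul_inv, ← Real.rpow_neg hT0.le]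
    norm_num
  rw [rate]
  rcases le_total m (1 + S) with hm | hm
  · have h1 := selfBound_small hA1 hK hS hm0 hm h
    have hK3 := le_three_mul_of_mul_log_le hK hA1 hKA
    have hl : Real.log (2 * (1 + S)) ≤ 2 + Real.log (1 + σ ^ 2 * T) := by
      have hS1 : 2 * (1 + S) ≤ 4 * (1 + σ ^ 2 * T) := by
        have hS3 : S ^ 3 = σ ^ 2 * T := rpow_third_pow hz
        nlinarith [mul_nonneg hS (sq_nonneg (S - 1)), sq_nonneg (S - 1), mul_nonneg hS hS]
      calc Real.log (2 * (1 + S)) ≤ Real.log (4 * (1 + σ ^ 2 * T)) :=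
            Real.log_le_log (by linarith) hS1
        _ = 2 * Real.log 2 + Real.log (1 + σ ^ 2 * T) := by
            rw [Real.log_mul (by norm_num) (by linarith)]
            rw [show (4:ℝ) = 2 ^ 2 by norm_num, Real.log_pow]; norm_num
        _ ≤ _ := by linarith [Real.log_two_lt_d9]
    -- The excess `2 K` is at most `6 A`.
    have hV : A + K * Real.log (2 * (1 + S)) ≤ 7 * A + K * Real.log (1 + σ ^ 2 * T) := by
      have := mul_le_mul_of_nonneg_left hl (by linarith : 0 ≤ K)
      linarith
    have hV0 : 0 ≤ A + K * Real.log (2 * (1 + S)) := by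
      have : 0 ≤ Real.log (2 * (1 + S)) := Real.log_nonneg (by linarith)
      positivity
    have hsub : ∀ a b : ℝ, 0 ≤ a → 0 ≤ b →
        (a + b) ^ (2 / 3 : ℝ) ≤ a ^ (2 / 3 : ℝ) + b ^ (2 / 3 : ℝ) := fun a b ha hb =>
      Real.rpow_add_le_add_rpow ha hb (by norm_num) (by norm_num)
    have hsq : ∀ a : ℝ, 0 ≤ a → (a ^ 2) ^ (2 / 3 : ℝ) = a ^ (4 / 3 : ℝ) := fun a ha => by
      rw [← Real.rpow_natCast, ← Real.rpow_mul ha]; norm_num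
    have hK23 : K ^ (2 / 3 : ℝ) ≤ (1 + G ^ (4 / 3 : ℝ)) * betaMax β ^ (2 / 3 : ℝ) := by
      rw [hKdef, Real.mul_rpow (by linarith) (by positivity), mul_comm]
      gcongr
      have := hsub 1 (G ^ 2) (by norm_num) (by positivity)
      rwa [Real.one_rpow, hsq G hG] at this
    have hA23 : A ^ (2 / 3 : ℝ) ≤ orderW₂ Δ σ G β := by
      rw [orderW₂, hK', hA, hW1]
      have i1 := hsub 1 (Δ + σ ^ 2 + G ^ 2 + K * Real.log K) (by norm_num) (by positivity)
      have i2 := hsub (Δ + σ ^ 2 + G ^ 2) (K * Real.log K) (by positivity) (by positivity)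
      have i3 := hsub (Δ + σ ^ 2) (G ^ 2) (by positivity) (by positivity)
      have i4 := hsub Δ (σ ^ 2) (by positivity) (by positivity)
      rw [Real.one_rpow] at i1
      rw [Real.mul_rpow (by linarith) hKlog] at i2
      rw [hsq G hG] at i3
      rw [hsq σ hσ] at i4
      have := mul_le_mul_of_nonneg_right hK23 hlogK0
      linarith
    have hV23 : (A + K * Real.log (2 * (1 + S))) ^ (2 / 3 : ℝ) ≤
        7 * orderW₂ Δ σ G β + orderW₃ G β * ℓ := by
      calc _ ≤ (7 * A + K * Real.log (1 + σ ^ 2 * T)) ^ (2 / 3 : ℝ) :=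
            Real.rpow_le_rpow hV0 hV (by norm_num)
        _ ≤ (7 * A) ^ (2 / 3 : ℝ) + (K * Real.log (1 + σ ^ 2 * T)) ^ (2 / 3 : ℝ) :=
            hsub _ _ (by linarith) (by positivity)
        _ = 7 ^ (2 / 3 : ℝ) * A ^ (2 / 3 : ℝ) + K ^ (2 / 3 : ℝ) * ℓ := by
            rw [Real.mul_rpow (by norm_num) (by linarith), Real.mul_rpow (by linarith) hlogz]
        _ ≤ 7 * orderW₂ Δ σ G β + orderW₃ G β * ℓ := by
            have h7 : (7:ℝ) ^ (2 / 3 : ℝ) ≤ 7 :=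
              Real.rpow_le_self_of_one_le (by norm_num) (by norm_num)
            rw [orderW₃]
            gcongr
    have hS13 : (1 + S) ^ (1 / 3 : ℝ) ≤ 1 + S ^ (1 / 3 : ℝ) := by
      have := Real.rpow_add_le_add_rpow (zero_le_one) hS (p := (1 / 3 : ℝ)) (by norm_num)
        (by norm_num)
      rwa [Real.one_rpow] at this
    have hm2 : m ≤ 492 * ((7 * orderW₂ Δ σ G β + orderW₃ G β * ℓ) * (1 + S ^ (1 / 3 : ℝ))) := by
      refine h1.trans ?_
      gcongr
    have hfin : m / (T : ℝ) ^ (1 / 3 : ℝ) ≤ 492 * ((7 * orderW₂ Δ σ G β + orderW₃ G β * ℓ) *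
        (1 / (T : ℝ) ^ (1 / 3 : ℝ) + σ ^ (2 / 9 : ℝ) / (T : ℝ) ^ (2 / 9 : ℝ))) := by
      rw [hσT', ← add_div, ← mul_div_assoc, ← mul_div_assoc]
      gcongr
    have hX : 0 ≤ 1 / (T : ℝ) ^ (1 / 3 : ℝ) + σ ^ (2 / 9 : ℝ) / (T : ℝ) ^ (2 / 9 : ℝ) := by
      positivity
    have hw : 492 * ((7 * orderW₂ Δ σ G β + orderW₃ G β * ℓ)) ≤
        10 ^ 5 * (2 * 10 ^ 10 * orderW₂ Δ σ G β + 1 * orderW₃ G β * ℓ) := by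
      have : 0 ≤ orderW₃ G β * ℓ := by positivity
      linarith
    have := mul_le_mul_of_nonneg_right hw hX
    linarith
  · have h1 := selfBound_large hA1 hK hKA hS hm h
    have hX : 2 * 10 ^ 10 * orderW₂ Δ σ G β / (T : ℝ) ^ (1 / 3 : ℝ) ≤
        (2 * 10 ^ 10 * orderW₂ Δ σ G β + 1 * orderW₃ G β * ℓ) *
        (1 / (T : ℝ) ^ (1 / 3 : ℝ) + σ ^ (2 / 9 : ℝ) / (T : ℝ) ^ (2 / 9 : ℝ)) := by
      rw [div_eq_mul_one_div]
      have : 0 ≤ 1 * orderW₃ G β * ℓ := by positivity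
      gcongr <;> linarith
    have h2 : m / (T : ℝ) ^ (1 / 3 : ℝ) ≤ 10 ^ 10 * A / (T : ℝ) ^ (1 / 3 : ℝ) := by gcongr
    -- If `orderW₁ ≥ 1` then `S ≤ m ≤ 10^10 A ≤ 2 * 10^10 * orderW₁`, so the indicator equals 1.
    -- Otherwise `A ≤ 2`, and the W₂ term suffices because `orderW₂ ≥ 1`.
    rcases le_total 1 (orderW₁ Δ σ G β) with hw | hw
    · have hmem : 2 * 10 ^ 10 * orderW₁ Δ σ G β ∈ {w : ℝ | S ≤ w} := by
        show S ≤ _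
        linarith
      rw [Set.indicator_of_mem hmem]
      have h3 : 10 ^ 10 * A / (T : ℝ) ^ (1 / 3 : ℝ) ≤
          2 * 10 ^ 10 * orderW₁ Δ σ G β / (T : ℝ) ^ (1 / 3 : ℝ) := by
        gcongr ?_ / _
        linarith
      have h4 : 0 ≤ 2 * 10 ^ 10 * orderW₂ Δ σ G β / (T : ℝ) ^ (1 / 3 : ℝ) := by positivity
      have h5 : 0 ≤ 2 * 10 ^ 10 * orderW₁ Δ σ G β / (T : ℝ) ^ (1 / 3 : ℝ) := by positivity
      simp only [Pi.one_apply, mul_one]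
      linarith
    · have h3 : 10 ^ 10 * A / (T : ℝ) ^ (1 / 3 : ℝ) ≤
          2 * 10 ^ 10 * orderW₂ Δ σ G β / (T : ℝ) ^ (1 / 3 : ℝ) := by
        gcongr ?_ / _
        linarith
      have h4 : 0 ≤ 2 * 10 ^ 10 * orderW₂ Δ σ G β / (T : ℝ) ^ (1 / 3 : ℝ) := by positivity
      linarith

end

/-! ### From moment estimates to the self-bounding inequality -/

section

/-- The tangent line of the logarithm at `y`, taken in the cube root of `1 + x`. With a
deterministic `y` it bounds the mean of a logarithm by the mean of a cube root. -/
theorem log_one_add_le_third {x : ℝ} (hx : 0 ≤ x) {y : ℝ} (hy : 0 < y) :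
    Real.log (1 + x) ≤ 3 * (Real.log y + (1 + x) ^ (1 / 3 : ℝ) / y - 1) := by
  have h1 : 0 < (1 + x) ^ (1 / 3 : ℝ) := by positivity
  have h2 : Real.log (1 + x) = 3 * Real.log ((1 + x) ^ (1 / 3 : ℝ)) := by
    rw [Real.log_rpow (by linarith)]; ring
  have h3 := Real.log_le_sub_one_of_pos (div_pos h1 hy)
  rw [Real.log_div h1.ne' hy.ne'] at h3
  linarith

theorem rpow_third_le_one_add {x : ℝ} (hx : 0 ≤ x) : x ^ (1 / 3 : ℝ) ≤ 1 + x := by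
  have h0 : 0 ≤ x ^ (1 / 3 : ℝ) := by positivity
  have h3 := rpow_third_pow hx
  nlinarith [sq_nonneg (x ^ (1 / 3 : ℝ) - 1), mul_nonneg h0 (sq_nonneg (x ^ (1 / 3 : ℝ) - 1))]

/-- Subadditivity of the cube root, then AM-GM to make the noise enter linearly. The weight `1 + S`
is the right scale because `Nv` will have mean at most `S ^ 3`. -/
theorem rpow_third_gradSum_le {Gv Hv Nv S : ℝ} (pG : 0 ≤ Gv) (pH : 0 ≤ Hv) (pN : 0 ≤ Nv)
    (hS : 0 ≤ S) (hG : Gv ≤ 2 * Hv + 2 * Nv) :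
    (1 + Gv) ^ (1 / 3 : ℝ) ≤
      1 + 2 * Hv ^ (1 / 3 : ℝ) + (2 / 3) * (Nv / (1 + S) ^ 2 + 2 * (1 + S)) := by
  have hk0 : 0 ≤ Hv ^ (1 / 3 : ℝ) := Real.rpow_nonneg pH _
  have hn0 : 0 ≤ Nv ^ (1 / 3 : ℝ) := Real.rpow_nonneg pN _
  have hu0 : 0 ≤ (1 + Gv) ^ (1 / 3 : ℝ) := Real.rpow_nonneg (by linarith [pG]) _
  have hk3 := rpow_third_pow pH
  have hn3 := rpow_third_pow pN
  have hu3 := rpow_third_pow (show 0 ≤ 1 + Gv by linarith [pG])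
  set k := Hv ^ (1 / 3 : ℝ)
  set n := Nv ^ (1 / 3 : ℝ)
  have h1 : (1 + Gv) ^ (1 / 3 : ℝ) ≤ 1 + 2 * k + 2 * n := by
    apply le_of_pow_le_pow_left₀ (n := 3) (by norm_num) (by positivity)
    rw [hu3]
    have e1 : 1 + Gv ≤ 1 + 2 * k ^ 3 + 2 * n ^ 3 := by
      rw [hk3, hn3]; linarith [hG]
    refine e1.trans ?_
    have : (1 + 2 * k + 2 * n) ^ 3 - (1 + 2 * k ^ 3 + 2 * n ^ 3) =
      6 * k ^ 3 + 6 * n ^ 3 + 6 * k + 6 * n + 12 * k ^ 2 + 12 * n ^ 2 + 24 * k * n +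
      24 * k ^ 2 * n + 24 * k * n ^ 2 := by ring
    have h2 : 0 ≤ 6 * k ^ 3 + 6 * n ^ 3 + 6 * k + 6 * n + 12 * k ^ 2 + 12 * n ^ 2 + 24 * k * n +
      24 * k ^ 2 * n + 24 * k * n ^ 2 := by positivity
    linarith
  have h2 : 3 * n ≤ Nv / (1 + S) ^ 2 + (1 + S) + (1 + S) := by
    apply three_mul_le_of_cube_le (div_nonneg pN (by positivity)) (by linarith)
      (by linarith)
    rw [hn3]
    field_simp
    rfl
  linarith

/-- With `u = (1 + Gv)^(1/3)`, the hypothesis bounds `Q = √(1 + Dv) / √u` by `1 + R`. Since `1 + Dv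
= Q² u`, AM-GM for `l Q`, `l Q` and `u / l²` separates the two factors. -/
theorem rpow_third_dirSum_le {Dv Gv R l : ℝ} (pD : 0 ≤ Dv) (pG : 0 ≤ Gv) (hl : 0 < l)
    (hD : Dv / (Real.sqrt (1 + Dv) * Real.sqrt ((1 + Gv) ^ (1 / 3 : ℝ))) ≤ R) :
    3 * (1 + Dv) ^ (1 / 3 : ℝ) ≤ 2 * l * (1 + R) + (1 + Gv) ^ (1 / 3 : ℝ) / l ^ 2 := by
  have d0 := pD
  have hq3 := rpow_third_pow (show 0 ≤ 1 + Dv by linarith)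
  have hu0 : 0 < (1 + Gv) ^ (1 / 3 : ℝ) := Real.rpow_pos_of_pos (by linarith [pG]) _
  have hu1 : 1 ≤ (1 + Gv) ^ (1 / 3 : ℝ) :=
    Real.one_le_rpow (by linarith [pG]) (by norm_num)
  have hDω := hD
  set u := (1 + Gv) ^ (1 / 3 : ℝ)
  set v := Real.sqrt (1 + Dv) with hv
  set w := Real.sqrt u with hw
  have hv2 : v ^ 2 = 1 + Dv := Real.sq_sqrt (by linarith)
  have hw2 : w ^ 2 = u := Real.sq_sqrt hu0.le
  have hv1 : 1 ≤ v := Real.one_le_sqrt.2 (by linarith)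
  have hw1 : 1 ≤ w := Real.one_le_sqrt.2 hu1
  have hQ : v / w ≤ 1 + Dv / (v * w) := by
    have h1 : Dv = v ^ 2 - 1 := by linarith
    have h2 : v / w - (v ^ 2 - 1) / (v * w) = 1 / (v * w) := by
      field_simp; ring
    have h3 : 1 / (v * w) ≤ 1 := by
      rw [div_le_one (by positivity)]; nlinarith
    rw [h1]; linarith
  have h3 : 3 * (1 + Dv) ^ (1 / 3 : ℝ) ≤ l * (v / w) + l * (v / w) + u / l ^ 2 := by
    apply three_mul_le_of_cube_le (by positivity) (by positivity) (by positivity)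
    rw [hq3, ← hv2, ← hw2]
    apply le_of_eq
    field_simp
  have h4 : l * (v / w) ≤
      l * (1 + R) := by
    gcongr; linarith
  linarith

/-- With `u = (1 + Gv)^(1/3)`, AM-GM for `(l / U) Ev`, `u / l²` and `l U` splits the product `u *
Ev`. The parameter `U` is a deterministic scale, chosen later so that the mean of `Ev` is of order
`U²`. -/
theorem rpow_third_objGradSum_le {Dv Gv Ev Hv U l : ℝ} (pD : 0 ≤ Dv) (pG : 0 ≤ Gv)
    (pE : 0 ≤ Ev) (pH : 0 ≤ Hv) (hl : 0 < l) (hU0 : 0 < U)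
    (hH : Hv ≤ 2 * Dv + 2 * (1 + Gv) ^ (1 / 3 : ℝ) * Ev) :
    3 * Hv ^ (1 / 3 : ℝ) ≤ 6 * (1 + Dv) ^ (1 / 3 : ℝ) +
      2 * (l / U * Ev + (1 + Gv) ^ (1 / 3 : ℝ) / l ^ 2 + l * U) := by
  have hu0 : 0 ≤ (1 + Gv) ^ (1 / 3 : ℝ) := Real.rpow_nonneg (by linarith [pG]) _
  have hHω := hH
  set u := (1 + Gv) ^ (1 / 3 : ℝ)
  have hr0 : 0 ≤ u * Ev := mul_nonneg hu0 pE
  have hr3 := rpow_third_pow hr0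
  have hrn : 0 ≤ (u * Ev) ^ (1 / 3 : ℝ) := Real.rpow_nonneg hr0 _
  set r := (u * Ev) ^ (1 / 3 : ℝ)
  have hq3 := rpow_third_pow (show 0 ≤ 1 + Dv by linarith [pD])
  have hqn : 0 ≤ (1 + Dv) ^ (1 / 3 : ℝ) := Real.rpow_nonneg (by linarith [pD]) _
  set z := (1 + Dv) ^ (1 / 3 : ℝ)
  have hk3 := rpow_third_pow pH
  set k := Hv ^ (1 / 3 : ℝ)
  have h1 : k ≤ 2 * z + 2 * r := by
    apply le_of_pow_le_pow_left₀ (n := 3) (by norm_num) (by positivity)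
    have e1 : k ^ 3 ≤ 2 * z ^ 3 + 2 * r ^ 3 := by
      rw [hk3, hq3, hr3]; linarith
    refine e1.trans ?_
    have : (2 * z + 2 * r) ^ 3 - (2 * z ^ 3 + 2 * r ^ 3) =
      6 * z ^ 3 + 6 * r ^ 3 + 24 * z ^ 2 * r + 24 * z * r ^ 2 := by ring
    have h2 : 0 ≤ 6 * z ^ 3 + 6 * r ^ 3 + 24 * z ^ 2 * r + 24 * z * r ^ 2 := by positivity
    linarith
  have h2 : 3 * r ≤ l / U * Ev + u / l ^ 2 + l * U := by
    apply three_mul_le_of_cube_le (mul_nonneg (by positivity) pE) (by positivity)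
      (by positivity)
    rw [hr3]
    apply le_of_eq
    field_simp
  linarith

section Moments

variable {Ω : Type*} [MeasurableSpace Ω] {P : Measure Ω}

theorem integrable_rpow_third [IsFiniteMeasure P] {X : Ω → ℝ} (hX : Integrable X P) (h0 : ∀ ω, 0 ≤ X ω) :
    Integrable (fun ω => X ω ^ (1 / 3 : ℝ)) P := by
  refine ((integrable_const (1:ℝ)).add hX).mono' ?_ (Filter.Eventually.of_forall fun ω => ?_)
  · exact (hX.aemeasurable.pow_const _).aestronglyMeasurable
  · rw [Real.norm_of_nonneg (Real.rpow_nonneg (h0 ω) _)]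
    exact rpow_third_le_one_add (h0 ω)

theorem integrable_log_one_add {X : Ω → ℝ} (hX : Integrable X P) (h0 : ∀ ω, 0 ≤ X ω) :
    Integrable (fun ω => Real.log (1 + X ω)) P := by
  refine hX.mono' ?_ (Filter.Eventually.of_forall fun ω => ?_)
  · exact (Real.measurable_log.comp_aemeasurable
      (hX.aemeasurable.const_add 1)).aestronglyMeasurable
  · rw [Real.norm_of_nonneg (Real.log_nonneg (by linarith [h0 ω]))]
    have := Real.log_le_sub_one_of_pos (show 0 < 1 + X ω by linarith [h0 ω])
    linarith

theorem integral_le_affine [IsProbabilityMeasure P] {X Y Z : Ω → ℝ} {a b c : ℝ}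
    (hX : Integrable X P) (hY : Integrable Y P) (hZ : Integrable Z P)
    (h : ∀ ω, X ω ≤ a * Y ω + b * Z ω + c) :
    ∫ ω, X ω ∂P ≤ a * ∫ ω, Y ω ∂P + b * ∫ ω, Z ω ∂P + c := by
  have i1 := hY.const_mul a
  have i2 := hZ.const_mul b
  have i3 : Integrable (fun ω => a * Y ω + b * Z ω) P := i1.add i2
  calc ∫ ω, X ω ∂P ≤ ∫ ω, (a * Y ω + b * Z ω + c) ∂P :=
        integral_mono hX (i3.add (integrable_const c)) h
    _ = _ := by
        rw [integral_add i3 (integrable_const c), integral_add i1 i2, integral_const_mul,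
          integral_const_mul]
        simp

set_option maxHeartbeats 600000 in
/-- The moment estimates of the run imply a self-bounding inequality for
`E[H^(1/3)] + E[(1 + D)^(1/3)]`. -/
theorem selfBound_of_moments [IsProbabilityMeasure P] {Dv Gv Ev Hv Nv : Ω → ℝ} {Δ σ β G S : ℝ}
    (hΔ : 0 ≤ Δ) (hβ : 0 ≤ β) (hS : 0 ≤ S)
    (iD : Integrable Dv P) (iG : Integrable Gv P) (iE : Integrable Ev P) (iH : Integrable Hv P)
    (iN : Integrable Nv P) (pD : ∀ ω, 0 ≤ Dv ω) (pG : ∀ ω, 0 ≤ Gv ω) (pE : ∀ ω, 0 ≤ Ev ω)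
    (pH : ∀ ω, 0 ≤ Hv ω) (pN : ∀ ω, 0 ≤ Nv ω)
    (hE : ∫ ω, Ev ω ∂P ≤ (1 + G ^ 2) * (σ ^ 2 + 4 * G ^ 2 +
      2 * β ^ 2 * ∫ ω, Real.log (1 + Dv ω) ∂P + 2 * ∫ ω, Real.log (1 + Gv ω) ∂P))
    (hD : ∀ ω, Dv ω / (Real.sqrt (1 + Dv ω) * Real.sqrt ((1 + Gv ω) ^ (1 / 3 : ℝ))) ≤
      Δ + Ev ω / (2 * (betaMax β * (1 + G ^ 2))) +
        (betaMax β * (1 + G ^ 2) / 2 + β) * Real.log (1 + Dv ω))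
    (hH : ∀ ω, Hv ω ≤ 2 * Dv ω + 2 * (1 + Gv ω) ^ (1 / 3 : ℝ) * Ev ω)
    (hG : ∀ ω, Gv ω ≤ 2 * Hv ω + 2 * Nv ω)
    (hN : ∫ ω, Nv ω ∂P ≤ S ^ 3) {m : ℝ}
    (hm : m = ∫ ω, Hv ω ^ (1 / 3 : ℝ) ∂P + ∫ ω, (1 + Dv ω) ^ (1 / 3 : ℝ) ∂P)
    (l : ℝ) (hl : 0 < l) :
    m ≤ 476 * l * (1 + orderW₁ Δ σ G β + betaMax β * (1 + G ^ 2) * Real.log (1 + m + S)) +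
      8 * (1 + m + S) / l ^ 2 := by
  set K := betaMax β * (1 + G ^ 2) with hKdef
  have hb1 : 1 ≤ betaMax β := le_max_right _ _
  have hbβ : β ≤ betaMax β := le_max_left _ _
  have hK : 1 ≤ K := by nlinarith [sq_nonneg G]
  have hK0 : 0 < K := by linarith
  have hbK : betaMax β ≤ K := by nlinarith [sq_nonneg G]
  have hKlog : 0 ≤ Real.log K := Real.log_nonneg hK
  have hK' : betaMax β + G ^ 2 * betaMax β = K := by rw [hKdef]; ring
  have hW1 : orderW₁ Δ σ G β = Δ + σ ^ 2 + G ^ 2 + K * Real.log K := by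
    rw [orderW₁, hK']
  set A := 1 + orderW₁ Δ σ G β with hA
  have hKl0 : 0 ≤ K * Real.log K := by positivity
  have hKA : K * Real.log K + 1 ≤ A := by
      have := sq_nonneg σ
      have := sq_nonneg G
      rw [hA, hW1]; linarith
  have hA1 : 1 ≤ A := by linarith
  have hK3 := le_three_mul_of_mul_log_le hK hA1 hKA
  have iq : Integrable (fun ω => (1 + Dv ω) ^ (1 / 3 : ℝ)) P :=
    integrable_rpow_third (X := fun ω => 1 + Dv ω) ((integrable_const 1).add iD)
      (fun ω => by linarith [pD ω])
  have iu : Integrable (fun ω => (1 + Gv ω) ^ (1 / 3 : ℝ)) P :=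
    integrable_rpow_third (X := fun ω => 1 + Gv ω) ((integrable_const 1).add iG)
      (fun ω => by linarith [pG ω])
  have ik := integrable_rpow_third iH pH
  have ilD := integrable_log_one_add iD pD
  have ilG := integrable_log_one_add iG pG
  set h := ∫ ω, Hv ω ^ (1 / 3 : ℝ) ∂P with hh
  set q := ∫ ω, (1 + Dv ω) ^ (1 / 3 : ℝ) ∂P with hq
  set Y := ∫ ω, (1 + Gv ω) ^ (1 / 3 : ℝ) ∂P with hY
  set lD := ∫ ω, Real.log (1 + Dv ω) ∂P with hlD
  set lG := ∫ ω, Real.log (1 + Gv ω) ∂P with hlG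
  set e := ∫ ω, Ev ω ∂P with he
  have hh0 : 0 ≤ h := integral_nonneg fun ω => Real.rpow_nonneg (pH ω) _
  have hq0 : 0 ≤ q := integral_nonneg fun ω => Real.rpow_nonneg (by linarith [pD ω]) _
  have hlD0 : 0 ≤ lD := integral_nonneg fun ω => Real.log_nonneg (by linarith [pD ω])
  have hlG0 : 0 ≤ lG := integral_nonneg fun ω => Real.log_nonneg (by linarith [pG ω])
  have hY0 : 0 ≤ Y := integral_nonneg fun ω => Real.rpow_nonneg (by linarith [pG ω]) _
  -- The deterministic point at which all logarithms are linearised; it dominates, up to constants,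
  -- the means of the cube roots of `1 + Dv` and `1 + Gv`.
  set y := 1 + m + S with hy
  have hy1 : 1 ≤ y := by linarith
  have hy0 : 0 < y := by linarith
  have hly : 0 ≤ Real.log y := Real.log_nonneg hy1
  -- the gradient sum
  have hYy : Y ≤ 4 * y := by
    have pt := fun ω => rpow_third_gradSum_le (pG ω) (pH ω) (pN ω) hS (hG ω)
    have := integral_le_affine (a := 2) (b := (2 / 3) / (1 + S) ^ 2)
      (c := 1 + (2 / 3) * (2 * (1 + S))) iu ik iN
      (fun ω => (pt ω).trans_eq (by ring))
    have e3 : (2 / 3) / (1 + S) ^ 2 * ∫ ω, Nv ω ∂P =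
      (2 / 3) * ((∫ ω, Nv ω ∂P) / (1 + S) ^ 2) := by ring
    have h3 : (∫ ω, Nv ω ∂P) / (1 + S) ^ 2 ≤ 1 + S := by
      rw [div_le_iff₀ (by positivity)]
      nlinarith [mul_nonneg hS hS]
    linarith
  have hlDy : lD ≤ 3 * Real.log y := by
    have := integral_le_affine (a := 3 / y) (b := 0) (c := 3 * (Real.log y - 1)) ilD iq iq
      (fun ω => (log_one_add_le_third (pD ω) hy0).trans_eq (by ring))
    have e3 : 3 / y * q = 3 * (q / y) := by ring
    have h3 : q / y ≤ 1 := by rw [div_le_one hy0]; linarith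
    linarith
  have hlGy : lG ≤ 3 * Real.log y + 9 := by
    have := integral_le_affine (a := 3 / y) (b := 0) (c := 3 * (Real.log y - 1)) ilG iu iu
      (fun ω => (log_one_add_le_third (pG ω) hy0).trans_eq (by ring))
    have e3 : 3 / y * Y = 3 * (Y / y) := by ring
    have h3 : Y / y ≤ 4 := by rw [div_le_iff₀ hy0]; linarith
    linarith
  set U := A + K * (lD + lG) with hU
  have hUA : A ≤ U := by
    have : 0 ≤ K * (lD + lG) := by positivity
    linarith
  have hU0 : 0 < U := by linarith
  -- Here the choice of `K` matters: `1 + G² ≤ K` and `β² (1 + G²) ≤ K²`. One factor `K` comes out,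
  -- so that `e / (2 K)` in the descent inequality is only of order `U`.
  have heK : e ≤ K * (4 * A + 2 * (K * (lD + lG))) := by
    refine hE.trans ?_
    have g1 : 1 + G ^ 2 ≤ K := by nlinarith [sq_nonneg G]
    have g2 : β ^ 2 * (1 + G ^ 2) ≤ K * K := by
      have : β ^ 2 ≤ betaMax β ^ 2 := by gcongr
      have h4 : β ^ 2 * (1 + G ^ 2) ≤ betaMax β ^ 2 * (1 + G ^ 2) := by gcongr
      have h5 : betaMax β ^ 2 * (1 + G ^ 2) = betaMax β * K := by rw [hKdef]; ring
      have h6 := mul_le_mul_of_nonneg_right hbK hK0.le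
      linarith
    have g3 : σ ^ 2 + 4 * G ^ 2 ≤ 4 * A := by
      have := sq_nonneg σ
      have := sq_nonneg G
      rw [hA, hW1]; linarith
    have g4 : (1 + G ^ 2) * (σ ^ 2 + 4 * G ^ 2) ≤ K * (4 * A) := by gcongr
    have g5 := mul_le_mul_of_nonneg_right g2 hlD0
    have g6 : (1 + G ^ 2) * lG ≤ K * K * lG := by
      have := le_mul_of_one_le_left hK0.le hK
      gcongr; linarith
    have e1 : (1 + G ^ 2) * (σ ^ 2 + 4 * G ^ 2 + 2 * β ^ 2 * lD + 2 * lG) =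
      (1 + G ^ 2) * (σ ^ 2 + 4 * G ^ 2) + 2 * (β ^ 2 * (1 + G ^ 2) * lD) +
        2 * ((1 + G ^ 2) * lG) := by ring
    have e2 : K * (4 * A + 2 * (K * (lD + lG))) =
      K * (4 * A) + 2 * (K * K * lD) + 2 * (K * K * lG) := by ring
    linarith
  have he12 : e ≤ 12 * U ^ 2 := by
    have h1 : 4 * A + 2 * (K * (lD + lG)) ≤ 4 * U := by
      have : 0 ≤ K * (lD + lG) := by positivity
      linarith
    have h2 : K * (4 * A + 2 * (K * (lD + lG))) ≤ (3 * U) * (4 * U) := by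
      apply mul_le_mul (by linarith) h1 (by positivity) (by linarith)
    have h3 : 3 * U * (4 * U) = 12 * U ^ 2 := by ring
    linarith
  -- the direction sum
  have hqb : 3 * q ≤ 8 * l * U + Y / l ^ 2 := by
    have pt := fun ω => rpow_third_dirSum_le (pD ω) (pG ω) hl (hD ω)
    have i1 : Integrable (fun ω => Ev ω / (2 * K) + (K / 2 + β) * Real.log (1 + Dv ω)) P :=
      (iE.div_const _).add (ilD.const_mul _)
    have := integral_le_affine (a := 2 * l) (b := 1 / l ^ 2) (c := 2 * l * (1 + Δ))
      (iq.const_mul 3) i1 iu (fun ω => (pt ω).trans_eq (by ring))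
    rw [integral_const_mul, integral_add (iE.div_const _) (ilD.const_mul _), integral_div,
      integral_const_mul] at this
    have e3 : 1 / l ^ 2 * Y = Y / l ^ 2 := by ring
    have h5 : e / (2 * K) ≤ 2 * A + K * (lD + lG) := by
      rw [div_le_iff₀ (by positivity)]; linarith
    have h6 : 1 + Δ ≤ A := by
      have := sq_nonneg σ
      have := sq_nonneg G
      rw [hA, hW1]; linarith
    have h7 : (K / 2 + β) * lD ≤ 2 * K * lD := by
      gcongr; linarith
    have h8 : 1 + Δ + e / (2 * K) + (K / 2 + β) * lD ≤ 4 * U := by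
      have : 0 ≤ K * lG := by positivity
      have : 0 ≤ K * lD := by positivity
      linarith
    have h9 := mul_le_mul_of_nonneg_left h8 (show 0 ≤ 2 * l by positivity)
    linarith
  -- the gradients of the objective
  have hhb : 3 * h ≤ 6 * q + 26 * l * U + 2 * (Y / l ^ 2) := by
    have pt := fun ω => rpow_third_objGradSum_le (pD ω) (pG ω) (pE ω) (pH ω) hl hU0 (hH ω)
    have i1 : Integrable (fun ω => 6 * (1 + Dv ω) ^ (1 / 3 : ℝ) + 2 * (l / U) * Ev ω) P :=
      (iq.const_mul _).add (iE.const_mul _)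
    have := integral_le_affine (a := 1) (b := 2 / l ^ 2) (c := 2 * (l * U))
      (ik.const_mul 3) i1 iu (fun ω => (pt ω).trans_eq (by ring))
    rw [integral_const_mul, integral_add (iq.const_mul _) (iE.const_mul _), integral_const_mul,
      integral_const_mul] at this
    have e3 : 2 / l ^ 2 * Y = 2 * (Y / l ^ 2) := by ring
    have h5 : l / U * e ≤ 12 * (l * U) := by
      rw [div_mul_eq_mul_div, div_le_iff₀ hU0]
      have h6 := mul_le_mul_of_nonneg_left he12 hl.le
      have h7 : 12 * (l * U) * U = l * (12 * U ^ 2) := by ring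
      linarith
    linarith
  have hYl : Y / l ^ 2 ≤ 4 * y / l ^ 2 := by gcongr
  have hUy : U ≤ 28 * A + 6 * (K * Real.log y) := by
    have : K * (lD + lG) ≤ K * (6 * Real.log y + 9) :=
      mul_le_mul_of_nonneg_left (by linarith) hK0.le
    linarith
  have hlU : l * U ≤ l * (28 * A + 6 * (K * Real.log y)) := by gcongr
  have e1 : 4 * y / l ^ 2 * 2 = 8 * y / l ^ 2 := by ring
  have hnn : 0 ≤ y / l ^ 2 := by positivity
  have hKl : 0 ≤ l * (K * Real.log y) := by positivity
  have hlA : 0 ≤ l * A := by positivity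
  have e2 : 8 * y / l ^ 2 = 8 * (y / l ^ 2) := by ring
  have e3 : 4 * y / l ^ 2 = 4 * (y / l ^ 2) := by ring
  rw [e2]
  rw [e3] at hYl
  -- Combining `hqb` and `hhb` gives `m ≤ (50/3) l U + (5/3) Y / l²`. With `U ≤ 28 A + 6 K log y`
  -- and `Y ≤ 4 y` the constants stay below `476 = 17 * 28` and 8.
  have e4 : 476 * l * (A + K * Real.log y) = 476 * (l * A) + 476 * (l * (K * Real.log y)) := by
    ring
  have e5 : l * (28 * A + 6 * (K * Real.log y)) = 28 * (l * A) + 6 * (l * (K * Real.log y)) := by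
    ring
  rw [e4]
  rw [e5] at hlU
  linarith

end Moments

end

/-! ### Variance recursion, descent lemma, and regularity of the gradients -/

section

theorem integral_norm_sub_mean_sq {Ξ E : Type*} [MeasurableSpace Ξ] {D : Measure Ξ}
    [IsProbabilityMeasure D] [NormedAddCommGroup E] [InnerProductSpace ℝ E] [CompleteSpace E]
    {X : Ξ → E} (hX : Integrable X D) (hX2 : Integrable (fun ξ => ‖X ξ‖ ^ 2) D) {c : E}
    (hc : ∫ ξ, X ξ ∂D = c) : ∫ ξ, ‖X ξ - c‖ ^ 2 ∂D = ∫ ξ, ‖X ξ‖ ^ 2 ∂D - ‖c‖ ^ 2 := by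
  have e : ∀ ξ, ‖X ξ - c‖ ^ 2 = ‖X ξ‖ ^ 2 - (2 * inner ℝ c (X ξ) - ‖c‖ ^ 2) := fun ξ => by
    rw [norm_sub_sq_real, real_inner_comm]; ring
  have i1 := (hX.const_inner (𝕜 := ℝ) c).const_mul 2
  have i2 : Integrable (fun ξ => 2 * inner ℝ c (X ξ) - ‖c‖ ^ 2) D := i1.sub (integrable_const _)
  simp_rw [e]
  rw [integral_sub hX2 i2, integral_sub i1 (integrable_const _), integral_const_mul,
    integral_inner hX, hc, real_inner_self_eq_norm_sq]
  simp only [integral_const, probReal_univ, one_smul]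
  ring

/-- The variance recursion of the momentum estimator for one fresh sample. -/
theorem integral_momentum_error_sq_le {Ξ E : Type*} [MeasurableSpace Ξ] {D : Measure Ξ}
    [IsProbabilityMeasure D] [NormedAddCommGroup E] [InnerProductSpace ℝ E] [CompleteSpace E]
    {gx gy : Ξ → E} (hx : AEStronglyMeasurable gx D) (hy : AEStronglyMeasurable gy D) {G : ℝ}
    (bx : ∀ᵐ ξ ∂D, ‖gx ξ‖ ≤ G) (bY : ∀ᵐ ξ ∂D, ‖gy ξ‖ ≤ G) {mx my v : E}
    (hmx : ∫ ξ, gx ξ ∂D = mx) (hmy : ∫ ξ, gy ξ ∂D = my) {a : ℝ} (ha0 : 0 ≤ a) (ha1 : a ≤ 1) :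
    ∫ ξ, ‖gy ξ + (1 - a) • (v - gx ξ) - my‖ ^ 2 ∂D ≤
      (1 - a) * ‖v - mx‖ ^ 2 + 2 * ∫ ξ, ‖gy ξ - gx ξ‖ ^ 2 ∂D +
        2 * a ^ 2 * ∫ ξ, ‖gy ξ‖ ^ 2 ∂D := by
  have isq : ∀ (X : Ξ → E) (C : ℝ), AEStronglyMeasurable X D → (∀ᵐ ξ ∂D, ‖X ξ‖ ≤ C) →
      Integrable (fun ξ => ‖X ξ‖ ^ 2) D := fun X C hX hC => by
    refine Integrable.of_bound (hX.norm.pow 2) (C ^ 2) (hC.mono fun ξ h => ?_)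
    rw [Real.norm_of_nonneg (by positivity)]
    gcongr
  have ix : Integrable gx D := Integrable.of_bound hx G bx
  have iy : Integrable gy D := Integrable.of_bound hy G bY
  have ixy : Integrable (fun ξ => gy ξ - gx ξ) D := iy.sub ix
  have bxy : ∀ᵐ ξ ∂D, ‖gy ξ - gx ξ‖ ≤ G + G := by
    filter_upwards [bx, bY] with ξ h1 h2
    exact (norm_sub_le _ _).trans (by linarith)
  have hmxy : ∫ ξ, (gy ξ - gx ξ) ∂D = my - mx := by rw [integral_sub iy ix, hmx, hmy]
  have hZ := (integral_norm_sub_mean_sq ixy (isq _ _ ixy.1 bxy) hmxy).trans_le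
    (sub_le_self _ (sq_nonneg _))
  have hN := (integral_norm_sub_mean_sq iy (isq _ _ hy bY) hmy).trans_le
    (sub_le_self _ (sq_nonneg _))
  set Z : Ξ → E := fun ξ => (gy ξ - gx ξ) - (my - mx) with hZdef
  set N : Ξ → E := fun ξ => gy ξ - my with hNdef
  have iZ : Integrable Z D := ixy.sub (integrable_const _)
  have iN : Integrable N D := iy.sub (integrable_const _)
  have hZ0 : ∫ ξ, Z ξ ∂D = 0 := by
    rw [hZdef, integral_sub ixy (integrable_const _), hmxy]; simp
  have hN0 : ∫ ξ, N ξ ∂D = 0 := by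
    rw [hNdef, integral_sub iy (integrable_const _), hmy]; simp
  have iZ2 : Integrable (fun ξ => ‖Z ξ‖ ^ 2) D := isq Z (G + G + ‖my - mx‖) iZ.1 (by
    filter_upwards [bxy] with ξ h
    exact (norm_sub_le _ _).trans (by linarith))
  have iN2 : Integrable (fun ξ => ‖N ξ‖ ^ 2) D := isq N (G + ‖my‖) iN.1 (by
    filter_upwards [bY] with ξ h
    exact (norm_sub_le _ _).trans (by linarith))
  set w : E := (1 - a) • (v - mx) with hw
  set R : Ξ → E := fun ξ => (1 - a) • Z ξ + a • N ξ with hR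
  have iR : Integrable R D := (iZ.smul (1 - a)).add (iN.smul a)
  have hR0 : ∫ ξ, R ξ ∂D = 0 := by
    have := integral_add (iZ.smul (1 - a)) (iN.smul a)
    simp only [Pi.smul_apply, integral_smul, hZ0, hN0, smul_zero, add_zero] at this
    exact this
  have pt : ∀ ξ, ‖gy ξ + (1 - a) • (v - gx ξ) - my‖ ^ 2 ≤
      (‖w‖ ^ 2 + 2 * inner ℝ w (R ξ)) + (2 * ‖Z ξ‖ ^ 2 + 2 * a ^ 2 * ‖N ξ‖ ^ 2) := by
    intro ξ
    -- The new error is the contracted old error plus a mean-zero term, so the cross term integrates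
    -- to zero.
    have e1 : gy ξ + (1 - a) • (v - gx ξ) - my = w + R ξ := by
      simp only [hw, hR, hZdef, hNdef]
      module
    have e2 : ‖R ξ‖ ≤ ‖Z ξ‖ + a * ‖N ξ‖ := by
      refine (norm_add_le _ _).trans ?_
      rw [norm_smul, norm_smul, Real.norm_of_nonneg ha0, Real.norm_of_nonneg (by linarith)]
      nlinarith [norm_nonneg (Z ξ)]
    have e3 : ‖R ξ‖ ^ 2 ≤ (‖Z ξ‖ + a * ‖N ξ‖) ^ 2 := by gcongr
    rw [e1, norm_add_sq_real]
    nlinarith [sq_nonneg (‖Z ξ‖ - a * ‖N ξ‖)]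
  have i1 := (iR.const_inner (𝕜 := ℝ) w).const_mul 2
  have i2 : Integrable (fun ξ => ‖w‖ ^ 2 + 2 * inner ℝ w (R ξ)) D := (integrable_const _).add i1
  have i3 : Integrable (fun ξ => 2 * ‖Z ξ‖ ^ 2 + 2 * a ^ 2 * ‖N ξ‖ ^ 2) D :=
    (iZ2.const_mul _).add (iN2.const_mul _)
  have h1 := integral_mono_of_nonneg (Filter.Eventually.of_forall fun ξ => sq_nonneg _)
    (i2.add i3) (Filter.Eventually.of_forall pt)
  rw [integral_add' i2 i3, integral_add (integrable_const _) i1,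
    integral_add (iZ2.const_mul _) (iN2.const_mul _), integral_const_mul, integral_const_mul,
    integral_const_mul, integral_inner iR, hR0, inner_zero_right] at h1
  simp only [integral_const, probReal_univ, one_smul, mul_zero, add_zero] at h1
  have h2 : ‖w‖ ^ 2 ≤ (1 - a) * ‖v - mx‖ ^ 2 := by
    rw [hw, norm_smul, Real.norm_of_nonneg (by linarith), mul_pow]
    have : (1 - a) ^ 2 ≤ 1 - a := by nlinarith
    gcongr
  have h3 := mul_le_mul_of_nonneg_left hN (show 0 ≤ 2 * a ^ 2 by positivity)
  linarith

/-- The mean value inequality on the segment, applied to `F` minus its linearisation at `x`. It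
loses the usual factor 1/2, which only affects constants. -/
theorem descent_of_lipschitz_gradient {E : Type*} [NormedAddCommGroup E] [InnerProductSpace ℝ E]
    [CompleteSpace E] {F : E → ℝ} {β : ℝ} (hF : Differentiable ℝ F)
    (hL : ∀ x y, ‖gradient F x - gradient F y‖ ≤ β * ‖x - y‖) (x y : E) :
    F y ≤ F x + inner ℝ (gradient F x) (y - x) + β * ‖y - x‖ ^ 2 := by
  have hβ : 0 ≤ β * ‖y - x‖ := (norm_nonneg _).trans (hL y x)
  have hd : ∀ z ∈ segment ℝ x y,
      HasFDerivWithinAt F (fderiv ℝ F z) (segment ℝ x y) z :=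
    fun z _ => (hF z).hasFDerivAt.hasFDerivWithinAt
  have hb : ∀ z ∈ segment ℝ x y, ‖fderiv ℝ F z - fderiv ℝ F x‖ ≤ β * ‖y - x‖ := by
    intro z hz
    have h1 : ‖fderiv ℝ F z - fderiv ℝ F x‖ = ‖gradient F z - gradient F x‖ := by
      rw [gradient, gradient, ← map_sub, LinearIsometryEquiv.norm_map]
    rw [h1]
    refine (hL z x).trans ?_
    have h2 : ‖z - x‖ ≤ ‖y - x‖ := norm_sub_le_of_mem_segment hz
    -- The sign of `β` is not assumed: a negative `β` contradicts `hβ` unless the segment is a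
    -- point.
    have h3 : ‖z - x‖ = 0 ∨ 0 ≤ β := by
      by_contra! h
      have : 0 < ‖y - x‖ := lt_of_lt_of_le (lt_of_le_of_ne (norm_nonneg _) (Ne.symm h.1)) h2
      nlinarith
    rcases h3 with h3 | h3
    · rw [h3, mul_zero]; exact hβ
    · gcongr
  have := (convex_segment x y).norm_image_sub_le_of_norm_hasFDerivWithin_le' hd hb
    (left_mem_segment ℝ x y) (right_mem_segment ℝ x y)
  have e : fderiv ℝ F x (y - x) = inner ℝ (gradient F x) (y - x) := by
    rw [gradient, InnerProductSpace.toDual_symm_apply]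
  rw [e, Real.norm_eq_abs] at this
  have := (abs_le.1 this).2
  nlinarith

variable {d : ℕ} {Ξ : Type*} [MeasurableSpace Ξ] {D : Measure Ξ}
  {f : EuclideanSpace ℝ (Fin d) → Ξ → ℝ}

/-- Joint measurability is needed because the gradient is evaluated at random points. `f` is jointly
measurable as a Carathéodory function, and each partial derivative is a limit of its difference
quotients with step `1/n`. -/
theorem measurable_stochGrad (hf : IsSamplingFunction D f) :
    Measurable (fun p : EuclideanSpace ℝ (Fin d) × Ξ => stochGrad f p.1 p.2) := by
  have hjoint : Measurable (Function.uncurry f) :=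
    measurable_uncurry_of_continuous_of_measurable
      (fun ξ => (hf.differentiable_sample ξ).continuous) hf.measurable_sample
  have hcoord : ∀ i, Measurable
      (fun p : EuclideanSpace ℝ (Fin d) × Ξ => stochGrad f p.1 p.2 i) := by
    intro i
    refine measurable_of_tendsto_metrizable (f := fun (n : ℕ) p => (n : ℝ) •
      (f (p.1 + (n : ℝ)⁻¹ • EuclideanSpace.single i (1:ℝ)) p.2 - f p.1 p.2)) ?_ ?_
    · intro n
      refine Measurable.const_smul (M := ℝ) (Measurable.sub ?_ hjoint) _
      exact hjoint.comp ((measurable_fst.add_const _).prodMk measurable_snd)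
    · rw [tendsto_pi_nhds]
      intro p
      have h1 := ((hf.differentiable_sample p.2) p.1).hasFDerivAt.lim
        (EuclideanSpace.single i (1:ℝ)) (c := fun n : ℕ => (n : ℝ)) (l := Filter.atTop)
        (by simpa using tendsto_natCast_atTop_atTop)
      have h2 : fderiv ℝ (fun x => f x p.2) p.1 (EuclideanSpace.single i (1:ℝ)) =
          stochGrad f p.1 p.2 i := by
        have h3 : fderiv ℝ (fun x => f x p.2) p.1 (EuclideanSpace.single i (1:ℝ)) =
            inner ℝ (stochGrad f p.1 p.2) (EuclideanSpace.single i (1:ℝ)) := by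
          rw [stochGrad, gradient, InnerProductSpace.toDual_symm_apply]
        rw [h3, EuclideanSpace.inner_single_right]
        simp
      rw [← h2]
      exact h1
  exact (MeasurableEquiv.toLp 2 (Fin d → ℝ)).measurable.comp (measurable_pi_iff.2 hcoord)

variable [IsProbabilityMeasure D] {σ β G : ℝ}

theorem norm_gradient_objective_le (hu : UnbiasedBoundedVariance D f σ)
    (hb : BoundedStochGrad D f G) (x : EuclideanSpace ℝ (Fin d)) :
    ‖gradient (objective D f) x‖ ≤ G := by
  rw [← (hu x).2.1]
  have := norm_integral_le_of_norm_le_const (μ := D) (f := stochGrad f x) (C := G)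
    (hb.mono fun ξ h => h x)
  simpa using this

/-- The variance of the difference of stochastic gradients is nonnegative, so its squared mean is at
most its second moment. -/
theorem norm_gradient_objective_sub_le (hβ : 0 ≤ β) (hu : UnbiasedBoundedVariance D f σ)
    (hs : AveragedSmooth D f β) (x y : EuclideanSpace ℝ (Fin d)) :
    ‖gradient (objective D f) x - gradient (objective D f) y‖ ≤ β * ‖x - y‖ := by
  have i : Integrable (fun ξ => stochGrad f x ξ - stochGrad f y ξ) D := (hu x).1.sub (hu y).1
  have e : ∫ ξ, (stochGrad f x ξ - stochGrad f y ξ) ∂D =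
      gradient (objective D f) x - gradient (objective D f) y := by
    rw [integral_sub (hu x).1 (hu y).1, (hu x).2.1, (hu y).2.1]
  have h1 := integral_norm_sub_mean_sq i (hs x y).1 e
  have h2 : 0 ≤ ∫ ξ, ‖stochGrad f x ξ - stochGrad f y ξ -
      (gradient (objective D f) x - gradient (objective D f) y)‖ ^ 2 ∂D :=
    integral_nonneg fun ξ => sq_nonneg _
  apply le_of_pow_le_pow_left₀ two_ne_zero (by positivity)
  have := (hs x y).2
  rw [mul_pow]
  linarith

end

/-! ### Pathwise estimates for one iteration, and measurability of the state -/

section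

theorem div_one_add_le_log_sub {X x : ℝ} (hx : 0 ≤ x) (h : x ≤ X) :
    x / (1 + X) ≤ Real.log (1 + X) - Real.log (1 + (X - x)) := by
  have h1 : 0 < 1 + X := by linarith
  have h2 : 0 < 1 + (X - x) := by linarith
  have h3 := Real.log_le_sub_one_of_pos (div_pos h2 h1)
  rw [Real.log_div h2.ne' h1.ne'] at h3
  have h4 : (1 + (X - x)) / (1 + X) = 1 - x / (1 + X) := by field_simp; ring
  linarith

/-- For use when the denominator does not yet contain the new term `x`. Replacing `1 + X` by `1 + X
+ x` costs at most `c` times the drop of the reciprocal, which telescopes too. -/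
theorem div_one_add_le_log_add {X x c : ℝ} (hX : 0 ≤ X) (hx : 0 ≤ x) (hc : x ≤ c) :
    x / (1 + X) ≤ Real.log (1 + (X + x)) - Real.log (1 + X) +
      (c / (1 + X) - c / (1 + (X + x))) := by
  have h1 := div_one_add_le_log_sub hx (show x ≤ X + x by linarith)
  rw [add_sub_cancel_right] at h1
  have h2 : 1 / (1 + (X + x)) ≤ 1 / (1 + X) := by gcongr; linarith
  have h3 : x * (1 / (1 + X) - 1 / (1 + (X + x))) ≤ c * (1 / (1 + X) - 1 / (1 + (X + x))) :=
    mul_le_mul_of_nonneg_right hc (by linarith)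
  have e1 : x * (1 / (1 + X) - 1 / (1 + (X + x))) = x / (1 + X) - x / (1 + (X + x)) := by ring
  have e2 : c * (1 / (1 + X) - 1 / (1 + (X + x))) = c / (1 + X) - c / (1 + (X + x)) := by ring
  linarith

variable {d : ℕ} {Ξ : Type*}

/-- `u_t = (1 + ∑_{i ≤ t} ‖∇f(x_i, ξ_i)‖²)^(1/3)`, so that `a_{t+1} = u_t^(-2)`. -/
def rootSum (s : State d) : ℝ := (1 + s.gradSum) ^ (1 / 3 : ℝ)

theorem rootSum_pow {s : State d} (h : 0 ≤ s.gradSum) : rootSum s ^ 3 = 1 + s.gradSum :=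
  rpow_third_pow (by linarith)

theorem one_le_rootSum {s : State d} (h : 0 ≤ s.gradSum) : 1 ≤ rootSum s :=
  Real.one_le_rpow (by linarith) (by norm_num)

theorem momentum_eq {s : State d} (h : 0 ≤ s.gradSum) : momentum 1 s = 1 / rootSum s ^ 2 := by
  rw [momentum, one_pow, div_one, Real.rpow_neg (by linarith), rpow_two_thirds (by linarith),
    rootSum]
  exact (one_div _).symm

theorem stepScale_eq {s : State d} (h : 0 ≤ s.gradSum) :
    stepScale 1 1 (1 / 2) s = Real.sqrt (1 + s.dirSum) * Real.sqrt (rootSum s) := by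
  have hu : 0 ≤ rootSum s := zero_le_one.trans (one_le_rootSum h)
  rw [stepScale, momentum_eq h, Real.one_rpow, ← Real.sqrt_eq_rpow, one_div,
    Real.inv_rpow (by positivity), div_inv_eq_mul, ← Real.rpow_natCast, ← Real.rpow_mul hu,
    Real.sqrt_eq_rpow (rootSum s)]
  norm_num

theorem stepScale_sq {s : State d} (h : 0 ≤ s.gradSum) (h' : 0 ≤ s.dirSum) :
    stepScale 1 1 (1 / 2) s ^ 2 = (1 + s.dirSum) * rootSum s := by
  rw [stepScale_eq h, mul_pow, Real.sq_sqrt (by linarith),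
    Real.sq_sqrt (zero_le_one.trans (one_le_rootSum h))]

theorem one_le_stepScale {s : State d} (h : 0 ≤ s.gradSum) (h' : 0 ≤ s.dirSum) :
    1 ≤ stepScale 1 1 (1 / 2) s := by
  rw [stepScale_eq h]
  have h1 : 1 ≤ Real.sqrt (1 + s.dirSum) := Real.one_le_sqrt.2 (by linarith)
  have h2 : 1 ≤ Real.sqrt (rootSum s) := Real.one_le_sqrt.2 (one_le_rootSum h)
  nlinarith

theorem nextPoint_sub (s : State d) :
    nextPoint 1 1 1 (1 / 2) s - s.x = -((1 / stepScale 1 1 (1 / 2) s) • s.dir) := by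
  rw [nextPoint]; abel

theorem norm_nextPoint_sub_sq {s : State d} (h : 0 ≤ s.gradSum) (h' : 0 ≤ s.dirSum) :
    ‖nextPoint 1 1 1 (1 / 2) s - s.x‖ ^ 2 = ‖s.dir‖ ^ 2 / ((1 + s.dirSum) * rootSum s) := by
  rw [nextPoint_sub, norm_neg, norm_smul, mul_pow, Real.norm_eq_abs, sq_abs, div_pow, one_pow,
    stepScale_sq h h']
  ring

/-- A state that META-STORM-SG can reach on bounded samples. -/
structure StateBound (M : ℝ) (s : State d) : Prop where
  gradSum_nonneg : 0 ≤ s.gradSum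
  gradSum_le : s.gradSum ≤ M
  norm_dir_le : ‖s.dir‖ ≤ M
  dir_sq_le : ‖s.dir‖ ^ 2 ≤ s.dirSum
  dirSum_le : s.dirSum ≤ M

theorem StateBound.dirSum_nonneg {M : ℝ} {s : State d} (h : StateBound M s) : 0 ≤ s.dirSum :=
  (sq_nonneg _).trans h.dir_sq_le

variable {f : EuclideanSpace ℝ (Fin d) → Ξ → ℝ}

theorem stateBound_init {G : ℝ} {x₁ : EuclideanSpace ℝ (Fin d)} {ξ : Ξ}
    (hb : ‖stochGrad f x₁ ξ‖ ≤ G) : StateBound (G + G ^ 2) (initState f x₁ ξ) := by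
  have h0 := norm_nonneg (stochGrad f x₁ ξ)
  have h1 : ‖stochGrad f x₁ ξ‖ ^ 2 ≤ G ^ 2 := by gcongr
  refine ⟨sq_nonneg _, ?_, ?_, le_rfl, ?_⟩
  · exact h1.trans (by linarith)
  · exact hb.trans (by nlinarith [sq_nonneg G])
  · exact h1.trans (by linarith)

theorem norm_nextDir_le {G M : ℝ} {s : State d} {ξ : Ξ} (hb : ∀ x, ‖stochGrad f x ξ‖ ≤ G)
    (hs : StateBound M s) : ‖nextDir 1 1 1 (1 / 2) f s ξ‖ ≤ 2 * G + M := by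
  have hu := one_le_rootSum hs.gradSum_nonneg
  have ha0 : 0 ≤ 1 / rootSum s ^ 2 := by positivity
  have ha1 : 1 / rootSum s ^ 2 ≤ 1 := by
    rw [div_le_one (by positivity)]; nlinarith
  rw [nextDir, momentum_eq hs.gradSum_nonneg]
  refine (norm_add_le _ _).trans ?_
  have h1 : ‖s.dir - stochGrad f s.x ξ‖ ≤ M + G :=
    (norm_sub_le _ _).trans (add_le_add hs.norm_dir_le (hb _))
  rw [norm_smul, Real.norm_of_nonneg (by linarith)]
  have h2 := hb (nextPoint 1 1 1 (1 / 2) s)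
  nlinarith [norm_nonneg (s.dir - stochGrad f s.x ξ)]

theorem stateBound_step {G M : ℝ} {s : State d} {ξ : Ξ} (hb : ∀ x, ‖stochGrad f x ξ‖ ≤ G)
    (hs : StateBound M s) :
    StateBound (M + G ^ 2 + (2 * G + M) + (2 * G + M) ^ 2) (step 1 1 1 (1 / 2) f s ξ) := by
  have hd := norm_nextDir_le hb hs
  have h0 := norm_nonneg (nextDir 1 1 1 (1 / 2) f s ξ)
  have hM : 0 ≤ M := (norm_nonneg _).trans hs.norm_dir_le
  have hG : 0 ≤ G := (norm_nonneg _).trans (hb s.x)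
  have h1 : ‖nextDir 1 1 1 (1 / 2) f s ξ‖ ^ 2 ≤ (2 * G + M) ^ 2 := by gcongr
  have h2 : ‖stochGrad f (nextPoint 1 1 1 (1 / 2) s) ξ‖ ^ 2 ≤ G ^ 2 := by gcongr; exact hb _
  have h3 := hs.gradSum_nonneg
  have h4 := hs.gradSum_le
  have h5 := hs.dirSum_nonneg
  have h6 := hs.dirSum_le
  refine ⟨?_, ?_, ?_, ?_, ?_⟩ <;> simp only [step]
  · positivity
  · nlinarith [sq_nonneg (2 * G + M)]
  · nlinarith [sq_nonneg (2 * G + M), sq_nonneg G]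
  · linarith
  · nlinarith [sq_nonneg (2 * G + M), sq_nonneg G]

/-! ### Measurability -/

instance : MeasurableSpace (State d) :=
  MeasurableSpace.comap (fun s : State d => (s.x, s.dir, s.gradSum, s.dirSum)) inferInstance

theorem measurable_toProd :
    Measurable (fun s : State d => (s.x, s.dir, s.gradSum, s.dirSum)) :=
  comap_measurable _

theorem measurable_x : Measurable (State.x (d := d)) := measurable_toProd.fst

theorem measurable_dir : Measurable (State.dir (d := d)) := measurable_toProd.snd.fst

theorem measurable_gradSum : Measurable (State.gradSum (d := d)) := measurable_toProd.snd.snd.fst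

theorem measurable_dirSum : Measurable (State.dirSum (d := d)) := measurable_toProd.snd.snd.snd

theorem measurable_state_mk {α : Type*} [MeasurableSpace α] {g : α → State d}
    (h1 : Measurable fun a => (g a).x) (h2 : Measurable fun a => (g a).dir)
    (h3 : Measurable fun a => (g a).gradSum) (h4 : Measurable fun a => (g a).dirSum) :
    Measurable g :=
  measurable_comap_iff.2 (h1.prodMk (h2.prodMk (h3.prodMk h4)))

theorem measurable_rootSum : Measurable (rootSum (d := d)) :=
  (measurable_gradSum.const_add 1).pow_const _

theorem measurable_momentum (a₀ : ℝ) : Measurable (momentum (d := d) a₀) :=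
  ((measurable_gradSum.div_const _).const_add 1).pow_const _

theorem measurable_nextPoint : Measurable (nextPoint (d := d) 1 1 1 (1 / 2)) := by
  have h : Measurable fun s : State d => 1 / stepScale 1 1 (1 / 2) s :=
    (((measurable_dirSum.const_add _).pow_const _).div
      ((measurable_momentum 1).pow_const _)).const_div 1
  exact measurable_x.sub (h.smul measurable_dir)

variable [MeasurableSpace Ξ] {D : Measure Ξ}

theorem measurable_initState (hf : IsSamplingFunction D f) (x₁ : EuclideanSpace ℝ (Fin d)) :
    Measurable (initState f x₁) := by
  have h : Measurable (stochGrad f x₁) :=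
    (measurable_stochGrad hf).comp (measurable_const.prodMk measurable_id)
  exact measurable_state_mk measurable_const h (h.norm.pow_const 2) (h.norm.pow_const 2)

theorem measurable_step (hf : IsSamplingFunction D f) :
    Measurable (fun p : State d × Ξ => step 1 1 1 (1 / 2) f p.1 p.2) := by
  have hy : Measurable (fun p : State d × Ξ => nextPoint 1 1 1 (1 / 2) p.1) :=
    measurable_nextPoint.comp measurable_fst
  have h1 : Measurable (fun p : State d × Ξ => stochGrad f (nextPoint 1 1 1 (1 / 2) p.1) p.2) :=
    (measurable_stochGrad hf).comp (hy.prodMk measurable_snd)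
  have h2 : Measurable (fun p : State d × Ξ => stochGrad f p.1.x p.2) :=
    (measurable_stochGrad hf).comp ((measurable_x.comp measurable_fst).prodMk measurable_snd)
  have h3 : Measurable (fun p : State d × Ξ => nextDir 1 1 1 (1 / 2) f p.1 p.2) :=
    h1.add ((((measurable_momentum 1).comp measurable_fst).const_sub 1).smul
      ((measurable_dir.comp measurable_fst).sub h2))
  exact measurable_state_mk hy h3 ((measurable_gradSum.comp measurable_fst).add
    (h1.norm.pow_const 2)) ((measurable_dirSum.comp measurable_fst).add (h3.norm.pow_const 2))

/-! ### One iteration -/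

/-- The estimation error `d_t - ∇F(x_t)`. -/
def err (D : Measure Ξ) (f : EuclideanSpace ℝ (Fin d) → Ξ → ℝ) (s : State d) :
    EuclideanSpace ℝ (Fin d) :=
  s.dir - gradient (objective D f) s.x

/-- The descent inequality for one iteration. -/
theorem dir_sq_div_stepScale_le {β K : ℝ} (hβ : 0 ≤ β) (hK : 0 < K)
    (hF : Differentiable ℝ (objective D f))
    (hL : ∀ x y, ‖gradient (objective D f) x - gradient (objective D f) y‖ ≤ β * ‖x - y‖)
    {s : State d} (h : 0 ≤ s.gradSum) (h' : ‖s.dir‖ ^ 2 ≤ s.dirSum) :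
    ‖s.dir‖ ^ 2 / stepScale 1 1 (1 / 2) s ≤
      objective D f s.x - objective D f (nextPoint 1 1 1 (1 / 2) s) +
        (‖err D f s‖ ^ 2 / rootSum s) / (2 * K) +
        (K / 2 + β) * (Real.log (1 + s.dirSum) - Real.log (1 + (s.dirSum - ‖s.dir‖ ^ 2))) := by
  have hd0 : 0 ≤ s.dirSum := (sq_nonneg _).trans h'
  have hu := one_le_rootSum h
  have hb := one_le_stepScale h hd0
  have hb2 := stepScale_sq h hd0
  have hdes := descent_of_lipschitz_gradient hF hL s.x (nextPoint 1 1 1 (1 / 2) s)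
  rw [norm_nextPoint_sub_sq h hd0, nextPoint_sub, inner_neg_right, inner_smul_right] at hdes
  have hin : inner ℝ (gradient (objective D f) s.x) s.dir =
      ‖s.dir‖ ^ 2 - inner ℝ (err D f s) s.dir := by
    rw [err, inner_sub_left, real_inner_self_eq_norm_sq]; ring
  rw [hin] at hdes
  have hcs := real_inner_le_norm (err D f s) s.dir
  have hlog := div_one_add_le_log_sub (sq_nonneg ‖s.dir‖) h'
  set b := stepScale 1 1 (1 / 2) s
  set u := rootSum s
  set ε := ‖err D f s‖
  set n := ‖s.dir‖
  set ℓ := Real.log (1 + s.dirSum) - Real.log (1 + (s.dirSum - n ^ 2))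
  -- Young's inequality with weight `K u`. The identity `b² = (1 + dirSum) u` turns the second term
  -- into a logarithmic increment.
  have hyoung : ε * n / b ≤ (ε ^ 2 / u) / (2 * K) + K / 2 * (n ^ 2 / (1 + s.dirSum)) := by
    have e1 : n ^ 2 / (1 + s.dirSum) = n ^ 2 * u / b ^ 2 := by
      rw [hb2]; field_simp
    rw [e1]
    have : (ε ^ 2 / u) / (2 * K) + K / 2 * (n ^ 2 * u / b ^ 2) - ε * n / b =
        (ε - K * u * n / b) ^ 2 / (2 * K * u) := by
      field_simp; ring
    have h2 : 0 ≤ (ε - K * u * n / b) ^ 2 / (2 * K * u) := by positivity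
    linarith
  have hq : n ^ 2 / ((1 + s.dirSum) * u) ≤ n ^ 2 / (1 + s.dirSum) := by
    apply div_le_div_of_nonneg_left (sq_nonneg _) (by linarith)
    nlinarith
  have h1 : β * (n ^ 2 / ((1 + s.dirSum) * u)) ≤ β * ℓ :=
    mul_le_mul_of_nonneg_left (hq.trans hlog) hβ
  have h2 : K / 2 * (n ^ 2 / (1 + s.dirSum)) ≤ K / 2 * ℓ :=
    mul_le_mul_of_nonneg_left hlog (by linarith)
  have h3 : inner ℝ (err D f s) s.dir / b ≤ ε * n / b := by gcongr
  have e2 : 1 / b * (n ^ 2 - inner ℝ (err D f s) s.dir) =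
      n ^ 2 / b - inner ℝ (err D f s) s.dir / b := by ring
  rw [e2] at hdes
  linarith

/-- The potential `(u_t + G²/3) ‖d_t - ∇F(x_t)‖²`, compensated for its expected increments. -/
def potential (D : Measure Ξ) (f : EuclideanSpace ℝ (Fin d) → Ξ → ℝ) (β G : ℝ) (s : State d) :
    ℝ :=
  (rootSum s + G ^ 2 / 3) * ‖err D f s‖ ^ 2 -
    2 * (1 + G ^ 2) * (β ^ 2 * Real.log (1 + (s.dirSum - ‖s.dir‖ ^ 2)) +
      Real.log (1 + s.gradSum) - G ^ 2 / (1 + s.gradSum))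

/-- A bound for the potential after the step that separates the fresh sample from the weights. -/
theorem potential_step_le {β G : ℝ} {s : State d} {ξ : Ξ}
    (hb : ∀ x, ‖stochGrad f x ξ‖ ≤ G) (h : 0 ≤ s.gradSum) :
    potential D f β G (step 1 1 1 (1 / 2) f s ξ) ≤
      (rootSum s + G ^ 2 / 3 + G ^ 2 / 3 / rootSum s ^ 2) *
        (‖err D f (step 1 1 1 (1 / 2) f s ξ)‖ ^ 2 - 2 * (1 / rootSum s ^ 2) ^ 2 *
          ‖stochGrad f (nextPoint 1 1 1 (1 / 2) s) ξ‖ ^ 2) -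
      2 * (1 + G ^ 2) * (β ^ 2 * Real.log (1 + s.dirSum) +
        Real.log (1 + s.gradSum) - G ^ 2 / (1 + s.gradSum)) := by
  have hu := one_le_rootSum h
  have hu3 := rootSum_pow h
  set x := ‖stochGrad f (nextPoint 1 1 1 (1 / 2) s) ξ‖ ^ 2 with hx
  have hx0 : 0 ≤ x := sq_nonneg _
  have hxG : x ≤ G ^ 2 := by rw [hx]; gcongr; exact hb _
  have hlog := div_one_add_le_log_add h hx0 hxG
  set s' := step 1 1 1 (1 / 2) f s ξ with hs'
  have hg' : s'.gradSum = s.gradSum + x := rfl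
  have hd' : s'.dirSum - ‖s'.dir‖ ^ 2 = s.dirSum := by
    rw [hs']; simp [step]
  have hu'1 := one_le_rootSum (s := s') (by rw [hg']; linarith)
  have hu'3 := rootSum_pow (s := s') (by rw [hg']; linarith)
  rw [potential, hd', hg']
  set u := rootSum s
  set u' := rootSum s'
  -- From `u'³ - u³ ≤ G²` and `u'³ - u³ ≥ 3 u² (u' - u)`. The bound no longer depends on the sample,
  -- so the weight can be taken out of the integral.
  have huu : u' ≤ u + G ^ 2 / 3 / u ^ 2 := by
    have h1 : u ≤ u' := by
      apply le_of_pow_le_pow_left₀ (n := 3) (by norm_num) (by linarith)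
      rw [hu3, hu'3, hg']; linarith
    have h2 : (u' - u) * (3 * u ^ 2) ≤ G ^ 2 := by
      have : (u' - u) * (u' ^ 2 + u * u' + u ^ 2) = x := by
        have : (u' - u) * (u' ^ 2 + u * u' + u ^ 2) = u' ^ 3 - u ^ 3 := by ring
        rw [this, hu3, hu'3, hg']; ring
      have h3 : (u' - u) * (3 * u ^ 2) ≤ (u' - u) * (u' ^ 2 + u * u' + u ^ 2) := by
        apply mul_le_mul_of_nonneg_left _ (by linarith)
        nlinarith
      linarith
    have h4 : u' - u ≤ G ^ 2 / 3 / u ^ 2 := by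
      rw [le_div_iff₀ (by positivity)]; linarith
    linarith
  have hE : (u' + G ^ 2 / 3) * ‖err D f s'‖ ^ 2 ≤
      (u + G ^ 2 / 3 + G ^ 2 / 3 / u ^ 2) * ‖err D f s'‖ ^ 2 :=
    mul_le_mul_of_nonneg_right (by linarith) (sq_nonneg _)
  -- The weight is at most `(1 + G²) u`, and `u a² = u^(-3) = 1 / (1 + gradSum)`: the exponent 2/3
  -- in the momentum makes the noise sum logarithmically.
  have hw : (u + G ^ 2 / 3 + G ^ 2 / 3 / u ^ 2) * ((1 / u ^ 2) ^ 2 * x) ≤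
      (1 + G ^ 2) * (x / (1 + s.gradSum)) := by
    have h1 : u + G ^ 2 / 3 + G ^ 2 / 3 / u ^ 2 ≤ (1 + G ^ 2) * u := by
      have : G ^ 2 / 3 / u ^ 2 ≤ G ^ 2 / 3 := by
        apply div_le_self (by positivity); nlinarith
      nlinarith [sq_nonneg G, mul_nonneg (sq_nonneg G) (show 0 ≤ u - 1 by linarith)]
    calc _ ≤ (1 + G ^ 2) * u * ((1 / u ^ 2) ^ 2 * x) :=
          mul_le_mul_of_nonneg_right h1 (by positivity)
      _ = (1 + G ^ 2) * (x / u ^ 3) := by field_simp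
      _ = _ := by rw [hu3]
  have hfin := mul_le_mul_of_nonneg_left hlog (show 0 ≤ 1 + G ^ 2 by positivity)
  linarith

end

/-! ### Expected decrease of the potential over one fresh sample -/

section

variable {d : ℕ} {Ξ : Type*} [MeasurableSpace Ξ] {D : Measure Ξ}
  {f : EuclideanSpace ℝ (Fin d) → Ξ → ℝ} {σ β G : ℝ}

theorem measurable_err (hm : Measurable (gradient (objective D f))) : Measurable (err D f) :=
  measurable_dir.sub (hm.comp measurable_x)

theorem measurable_potential (hm : Measurable (gradient (objective D f))) :
    Measurable (potential D f β G) := by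
  have h1 := (measurable_rootSum (d := d)).add_const (G ^ 2 / 3)
  have h2 := (measurable_err hm).norm.pow_const 2
  have h3 : Measurable fun s : State d => Real.log (1 + (s.dirSum - ‖s.dir‖ ^ 2)) :=
    Real.measurable_log.comp
      ((measurable_dirSum.sub (measurable_dir.norm.pow_const 2)).const_add 1)
  have h4 : Measurable fun s : State d => Real.log (1 + s.gradSum) :=
    Real.measurable_log.comp (measurable_gradSum.const_add 1)
  have h5 : Measurable fun s : State d => G ^ 2 / (1 + s.gradSum) :=
    (measurable_gradSum.const_add 1).const_div _
  exact (h1.mul h2).sub ((((h3.const_mul _).add h4).sub h5).const_mul _)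

theorem norm_err_le {M : ℝ} (hg : ∀ x, ‖gradient (objective D f) x‖ ≤ G) {s : State d}
    (hs : StateBound M s) : ‖err D f s‖ ≤ M + G :=
  (norm_sub_le _ _).trans (add_le_add hs.norm_dir_le (hg _))

theorem rootSum_le {M : ℝ} {s : State d} (hs : StateBound M s) : rootSum s ≤ 1 + M := by
  have h := one_le_rootSum hs.gradSum_nonneg
  have h3 := rootSum_pow hs.gradSum_nonneg
  have := hs.gradSum_le
  nlinarith [sq_nonneg (rootSum s - 1)]

theorem abs_potential_le {M : ℝ} (hg : ∀ x, ‖gradient (objective D f) x‖ ≤ G) {s : State d}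
    (hs : StateBound M s) :
    |potential D f β G s| ≤ (1 + M + G ^ 2 / 3) * (M + G) ^ 2 +
      2 * (1 + G ^ 2) * (β ^ 2 * M + M + G ^ 2) := by
  have hM : 0 ≤ M := hs.gradSum_nonneg.trans hs.gradSum_le
  have h1 := rootSum_le hs
  have h1' := one_le_rootSum hs.gradSum_nonneg
  have h2 := norm_err_le hg hs
  have hlog : ∀ x : ℝ, 0 ≤ x → x ≤ M → 0 ≤ Real.log (1 + x) ∧ Real.log (1 + x) ≤ M := by
    intro x h0 hM
    have := Real.log_le_sub_one_of_pos (show 0 < 1 + x by linarith)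
    exact ⟨Real.log_nonneg (by linarith), by linarith⟩
  have h3 := hlog (s.dirSum - ‖s.dir‖ ^ 2) (by linarith [hs.dir_sq_le])
    (by linarith [hs.dirSum_le, sq_nonneg ‖s.dir‖])
  have h4 := hlog s.gradSum hs.gradSum_nonneg hs.gradSum_le
  have h5 : G ^ 2 / (1 + s.gradSum) ≤ G ^ 2 :=
    div_le_self (sq_nonneg _) (by linarith [hs.gradSum_nonneg])
  have h5' : 0 ≤ G ^ 2 / (1 + s.gradSum) :=
    div_nonneg (sq_nonneg _) (by linarith [hs.gradSum_nonneg])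
  have h6 : (rootSum s + G ^ 2 / 3) * ‖err D f s‖ ^ 2 ≤ (1 + M + G ^ 2 / 3) * (M + G) ^ 2 := by
    gcongr
  have h6' : 0 ≤ (rootSum s + G ^ 2 / 3) * ‖err D f s‖ ^ 2 := by positivity
  have h7 := mul_le_mul_of_nonneg_left h3.2 (sq_nonneg β)
  have h7' := mul_nonneg (sq_nonneg β) h3.1
  set R := β ^ 2 * Real.log (1 + (s.dirSum - ‖s.dir‖ ^ 2)) + Real.log (1 + s.gradSum) -
    G ^ 2 / (1 + s.gradSum) with hR
  have h8 : |R| ≤ β ^ 2 * M + M + G ^ 2 := by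
    rw [abs_le]; constructor <;> nlinarith [sq_nonneg β]
  rw [potential, ← hR]
  refine (abs_sub _ _).trans (add_le_add ?_ ?_)
  · rw [abs_of_nonneg h6']; exact h6
  · rw [abs_mul, abs_of_nonneg (by positivity)]
    gcongr

theorem integrable_of_stateBound {α : Type*} [MeasurableSpace α] {μ : Measure α}
    [IsFiniteMeasure μ] {g : α → State d} (hg : Measurable g) {M : ℝ}
    (hb : ∀ᵐ a ∂μ, StateBound M (g a)) {φ : State d → ℝ} (hφ : Measurable φ) {C : ℝ}
    (hC : ∀ s, StateBound M s → |φ s| ≤ C) : Integrable (fun a => φ (g a)) μ :=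
  Integrable.of_bound (hφ.comp hg).aestronglyMeasurable C (hb.mono fun _ h => hC _ h)

variable [IsProbabilityMeasure D]

theorem measurable_gradient_objective (hβ : 0 ≤ β) (hu : UnbiasedBoundedVariance D f σ)
    (hs : AveragedSmooth D f β) : Measurable (gradient (objective D f)) :=
  (LipschitzWith.of_dist_le_mul (K := ⟨β, hβ⟩) fun x y => by
    rw [dist_eq_norm, dist_eq_norm]
    exact norm_gradient_objective_sub_le hβ hu hs x y).continuous.measurable

/-- The potential is a supermartingale up to the weighted squared error. -/
theorem integral_potential_step_le (hβ : 0 ≤ β) (hf : IsSamplingFunction D f)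
    (hu : UnbiasedBoundedVariance D f σ) (hs : AveragedSmooth D f β)
    (hb : BoundedStochGrad D f G) {M : ℝ} {s : State d} (hM : StateBound M s) :
    ∫ ξ, potential D f β G (step 1 1 1 (1 / 2) f s ξ) ∂D ≤
      potential D f β G s - ‖err D f s‖ ^ 2 / rootSum s := by
  have hmg := measurable_gradient_objective hβ hu hs
  have hg := norm_gradient_objective_le hu hb
  have h := hM.gradSum_nonneg
  have hu1 := one_le_rootSum h
  have hu3 := rootSum_pow h
  have hstep : Measurable (step 1 1 1 (1 / 2) f s) :=
    (measurable_step hf).comp (measurable_const.prodMk measurable_id)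
  have hbd := hb.mono fun ξ hξ => stateBound_step hξ hM
  have hgx : ∀ x, Measurable (stochGrad f x) := fun x =>
    (measurable_stochGrad hf).comp (measurable_const.prodMk measurable_id)
  set y := nextPoint 1 1 1 (1 / 2) s with hy
  set a := 1 / rootSum s ^ 2 with ha
  have ha0 : 0 ≤ a := by positivity
  have ha1 : a ≤ 1 := by
    rw [ha, div_le_one (by positivity)]; nlinarith
  have iP := integrable_of_stateBound hstep hbd (measurable_potential (β := β) (G := G) hmg)
    (fun s' h' => abs_potential_le hg h')
  have iE : Integrable (fun ξ => ‖err D f (step 1 1 1 (1 / 2) f s ξ)‖ ^ 2) D :=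
    integrable_of_stateBound hstep hbd ((measurable_err hmg).norm.pow_const 2)
      (fun s' h' => by
        rw [abs_of_nonneg (by positivity)]
        exact pow_le_pow_left₀ (norm_nonneg _) (norm_err_le hg h') 2)
  have iY : Integrable (fun ξ => ‖stochGrad f y ξ‖ ^ 2) D :=
    Integrable.of_bound ((hgx y).norm.pow_const 2).aestronglyMeasurable (G ^ 2)
      (hb.mono fun ξ hξ => by
        rw [Real.norm_of_nonneg (by positivity)]
        exact pow_le_pow_left₀ (norm_nonneg _) (hξ y) 2)
  have key := integral_momentum_error_sq_le (D := D) (v := s.dir)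
    (hgx s.x).aestronglyMeasurable (hgx y).aestronglyMeasurable (G := G)
    (hb.mono fun ξ hξ => hξ s.x) (hb.mono fun ξ hξ => hξ y) (hu s.x).2.1 (hu y).2.1 ha0 ha1
  have hkey : ∫ ξ, ‖err D f (step 1 1 1 (1 / 2) f s ξ)‖ ^ 2 ∂D ≤
      (1 - a) * ‖err D f s‖ ^ 2 +
        2 * (β ^ 2 * (‖s.dir‖ ^ 2 / ((1 + s.dirSum) * rootSum s))) +
          2 * a ^ 2 * ∫ ξ, ‖stochGrad f y ξ‖ ^ 2 ∂D := by
    have e1 : ∀ ξ, err D f (step 1 1 1 (1 / 2) f s ξ) =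
        stochGrad f y ξ + (1 - a) • (s.dir - stochGrad f s.x ξ) - gradient (objective D f) y := by
      intro ξ
      simp only [err, step, nextDir, momentum_eq h]
      rfl
    simp_rw [e1]
    have h2 := (hs y s.x).2
    rw [hy, norm_nextPoint_sub_sq h hM.dirSum_nonneg] at h2
    rw [err]
    linarith
  set w := rootSum s + G ^ 2 / 3 + G ^ 2 / 3 / rootSum s ^ 2 with hw
  have hw0 : 0 ≤ w := by positivity
  set R := 2 * (1 + G ^ 2) * (β ^ 2 * Real.log (1 + s.dirSum) +
        Real.log (1 + s.gradSum) - G ^ 2 / (1 + s.gradSum)) with hR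
  have i1 : Integrable (fun ξ => ‖err D f (step 1 1 1 (1 / 2) f s ξ)‖ ^ 2 -
      2 * a ^ 2 * ‖stochGrad f y ξ‖ ^ 2) D := iE.sub (iY.const_mul _)
  have h1 : ∫ ξ, potential D f β G (step 1 1 1 (1 / 2) f s ξ) ∂D ≤
      ∫ ξ, (w * (‖err D f (step 1 1 1 (1 / 2) f s ξ)‖ ^ 2 -
      2 * a ^ 2 * ‖stochGrad f y ξ‖ ^ 2) - R) ∂D :=
    integral_mono_ae iP ((i1.const_mul w).sub (integrable_const R))
      (hb.mono fun ξ hξ => potential_step_le hξ h)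
  rw [integral_sub (i1.const_mul w) (integrable_const R), integral_const_mul,
    integral_sub iE (iY.const_mul _), integral_const_mul] at h1
  simp only [integral_const, probReal_univ, one_smul] at h1
  have h2 := mul_le_mul_of_nonneg_left (sub_le_iff_le_add.2 hkey) hw0
  have hlog := div_one_add_le_log_sub (sq_nonneg ‖s.dir‖) hM.dir_sq_le
  have h3 : w * (1 - a) ≤ rootSum s + G ^ 2 / 3 - 1 / rootSum s := by
    -- The contraction of the constant part, `a G²/3`, cancels exactly the growth `G² / (3 u²)` of
    -- the weight; this is why the constant is `G²/3`.
    have e : w * (1 - a) = rootSum s + G ^ 2 / 3 - 1 / rootSum s - G ^ 2 / 3 * a ^ 2 := by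
      rw [hw, ha]; field_simp; ring
    have : 0 ≤ G ^ 2 / 3 * a ^ 2 := by positivity
    linarith
  have h4 : w ≤ (1 + G ^ 2) * rootSum s := by
    have : G ^ 2 / 3 / rootSum s ^ 2 ≤ G ^ 2 / 3 := by
      apply div_le_self (by positivity); nlinarith
    nlinarith [sq_nonneg G, mul_nonneg (sq_nonneg G) (show 0 ≤ rootSum s - 1 by linarith)]
  have hd0 := hM.dirSum_nonneg
  have h5 : w * (β ^ 2 * (‖s.dir‖ ^ 2 / ((1 + s.dirSum) * rootSum s))) ≤
      (1 + G ^ 2) * (β ^ 2 * (Real.log (1 + s.dirSum) -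
        Real.log (1 + (s.dirSum - ‖s.dir‖ ^ 2)))) := by
    calc _ ≤ (1 + G ^ 2) * rootSum s *
          (β ^ 2 * (‖s.dir‖ ^ 2 / ((1 + s.dirSum) * rootSum s))) :=
          mul_le_mul_of_nonneg_right h4 (by positivity)
      _ = (1 + G ^ 2) * (β ^ 2 * (‖s.dir‖ ^ 2 / (1 + s.dirSum))) := by field_simp
      _ ≤ _ := by gcongr
  have h6 := mul_le_mul_of_nonneg_right h3 (sq_nonneg ‖err D f s‖)
  rw [potential]
  have e7 : (rootSum s + G ^ 2 / 3 - 1 / rootSum s) * ‖err D f s‖ ^ 2 =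
      (rootSum s + G ^ 2 / 3) * ‖err D f s‖ ^ 2 - ‖err D f s‖ ^ 2 / rootSum s := by ring
  linarith

/-- Conditioning on the past, done by Fubini: by independence the joint law is the product of the
law of `X` with `D`. -/
theorem integral_comp_le_of_indepFun {Ω S : Type*} [MeasurableSpace Ω] [MeasurableSpace S]
    {P : Measure Ω} [IsProbabilityMeasure P] {X : Ω → S} {Y : Ω → Ξ} (hX : Measurable X)
    (hY : Measurable Y) (hXY : IndepFun X Y P) (hYD : P.map Y = D) {φ : S × Ξ → ℝ}
    (hφ : Measurable φ) (hi : Integrable (fun ω => φ (X ω, Y ω)) P) {ψ : S → ℝ}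
    (hψ : Integrable (fun ω => ψ (X ω)) P)
    (h : ∀ᵐ ω ∂P, ∫ ξ, φ (X ω, ξ) ∂D ≤ ψ (X ω)) :
    ∫ ω, φ (X ω, Y ω) ∂P ≤ ∫ ω, ψ (X ω) ∂P := by
  have hprod : P.map (fun ω => (X ω, Y ω)) = (P.map X).prod D := by
    rw [(indepFun_iff_map_prod_eq_prod_map_map hX.aemeasurable hY.aemeasurable).1 hXY, hYD]
  have : IsProbabilityMeasure (P.map X) := Measure.isProbabilityMeasure_map hX.aemeasurable
  have hi' : Integrable φ ((P.map X).prod D) := by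
    rw [← hprod]
    exact (integrable_map_measure hφ.aestronglyMeasurable (hX.prodMk hY).aemeasurable).2 hi
  have e1 : ∫ ω, φ (X ω, Y ω) ∂P = ∫ ω, ∫ ξ, φ (X ω, ξ) ∂D ∂P := by
    calc ∫ ω, φ (X ω, Y ω) ∂P = ∫ z, φ z ∂(P.map (fun ω => (X ω, Y ω))) :=
          (integral_map (hX.prodMk hY).aemeasurable hφ.aestronglyMeasurable).symm
      _ = ∫ s, ∫ ξ, φ (s, ξ) ∂D ∂(P.map X) := by rw [hprod, integral_prod _ hi']
      _ = _ := integral_map hX.aemeasurable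
          hi'.integral_prod_left.aestronglyMeasurable
  rw [e1]
  have hi2 : Integrable (fun ω => ∫ ξ, φ (X ω, ξ) ∂D) P :=
    (integrable_map_measure hi'.integral_prod_left.aestronglyMeasurable hX.aemeasurable).1
      hi'.integral_prod_left
  exact integral_mono_ae hi2 hψ h

end

/-! ### Runs of the algorithm: pathwise sums, measurability, independence -/

section

variable {d : ℕ} {Ξ : Type*} {f : EuclideanSpace ℝ (Fin d) → Ξ → ℝ}
  {x₁ : EuclideanSpace ℝ (Fin d)}

/-- META-STORM-SG with `p = 1/2` and `a₀ = b₀ = η = 1`, with time starting at `0`. -/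
def run (f : EuclideanSpace ℝ (Fin d) → Ξ → ℝ) (x₁ : EuclideanSpace ℝ (Fin d)) (ζ : ℕ → Ξ) :
    ℕ → State d
  | 0 => initState f x₁ (ζ 0)
  | n + 1 => step 1 1 1 (1 / 2) f (run f x₁ ζ n) (ζ (n + 1))

theorem state_succ_eq_run (ξ : ℕ → Ξ) (n : ℕ) :
    state 1 1 1 (1 / 2) f x₁ ξ (n + 1) = run f x₁ (fun i => ξ (i + 1)) n := by
  induction n with
  | zero => rfl
  | succ n ih => rw [state, ih, run]

theorem run_succ_x (ζ : ℕ → Ξ) (n : ℕ) :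
    (run f x₁ ζ (n + 1)).x = nextPoint 1 1 1 (1 / 2) (run f x₁ ζ n) := rfl

theorem gradSum_run (ζ : ℕ → Ξ) (n : ℕ) : (run f x₁ ζ n).gradSum =
    ∑ i ∈ Finset.range (n + 1), ‖stochGrad f (run f x₁ ζ i).x (ζ i)‖ ^ 2 := by
  induction n with
  | zero => simp [run, initState]
  | succ n ih => rw [Finset.sum_range_succ, ← ih]; rfl

theorem dirSum_run (ζ : ℕ → Ξ) (n : ℕ) : (run f x₁ ζ n).dirSum =
    ∑ i ∈ Finset.range (n + 1), ‖(run f x₁ ζ i).dir‖ ^ 2 := by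
  induction n with
  | zero => simp [run, initState]
  | succ n ih => rw [Finset.sum_range_succ, ← ih]; rfl

theorem gradSum_run_nonneg (ζ : ℕ → Ξ) (n : ℕ) : 0 ≤ (run f x₁ ζ n).gradSum := by
  rw [gradSum_run]; positivity

theorem dir_sq_le_dirSum_run (ζ : ℕ → Ξ) (n : ℕ) :
    ‖(run f x₁ ζ n).dir‖ ^ 2 ≤ (run f x₁ ζ n).dirSum := by
  rw [dirSum_run]
  exact Finset.single_le_sum (f := fun i => ‖(run f x₁ ζ i).dir‖ ^ 2)
    (fun i _ => sq_nonneg _) (Finset.self_mem_range_succ n)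

theorem dirSum_run_nonneg (ζ : ℕ → Ξ) (n : ℕ) : 0 ≤ (run f x₁ ζ n).dirSum :=
  (sq_nonneg _).trans (dir_sq_le_dirSum_run ζ n)

theorem gradSum_run_le_succ (ζ : ℕ → Ξ) (n : ℕ) :
    (run f x₁ ζ n).gradSum ≤ (run f x₁ ζ (n + 1)).gradSum :=
  le_add_of_nonneg_right (sq_nonneg _)

theorem rootSum_run_mono (ζ : ℕ → Ξ) : Monotone fun n => rootSum (run f x₁ ζ n) :=
  monotone_nat_of_le_succ fun n => by
    have := gradSum_run_nonneg (f := f) (x₁ := x₁) ζ n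
    exact Real.rpow_le_rpow (by linarith)
      (by linarith [gradSum_run_le_succ (f := f) (x₁ := x₁) ζ n]) (by norm_num)

theorem stepScale_run_le_succ (ζ : ℕ → Ξ) (n : ℕ) :
    stepScale 1 1 (1 / 2) (run f x₁ ζ n) ≤ stepScale 1 1 (1 / 2) (run f x₁ ζ (n + 1)) := by
  rw [stepScale_eq (gradSum_run_nonneg ζ n), stepScale_eq (gradSum_run_nonneg ζ (n + 1))]
  have h1 : (run f x₁ ζ n).dirSum ≤ (run f x₁ ζ (n + 1)).dirSum :=
    le_add_of_nonneg_right (sq_nonneg _)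
  have h2 := rootSum_run_mono (f := f) (x₁ := x₁) ζ n.le_succ
  gcongr

/-- The bound grows with `n` and serves only for integrability; it never enters the rate. -/
theorem exists_stateBound_run (f : EuclideanSpace ℝ (Fin d) → Ξ → ℝ)
    (x₁ : EuclideanSpace ℝ (Fin d)) (G : ℝ) (n : ℕ) : ∃ M, ∀ ζ : ℕ → Ξ,
    (∀ i x, ‖stochGrad f x (ζ i)‖ ≤ G) → StateBound M (run f x₁ ζ n) := by
  induction n with
  | zero => exact ⟨_, fun ζ h => stateBound_init (h 0 x₁)⟩
  | succ n ih =>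
    obtain ⟨M, hM⟩ := ih
    exact ⟨_, fun ζ h => stateBound_step (h (n + 1)) (hM ζ h)⟩

variable [MeasurableSpace Ξ] {D : Measure Ξ} {σ β G : ℝ}

/-- The descent inequality summed along a run. -/
theorem dirSum_div_stepScale_run_le {K : ℝ} (hβ : 0 ≤ β) (hK : 0 < K)
    (hF : Differentiable ℝ (objective D f))
    (hL : ∀ x y, ‖gradient (objective D f) x - gradient (objective D f) y‖ ≤ β * ‖x - y‖)
    (ζ : ℕ → Ξ) (n : ℕ) :
    (run f x₁ ζ n).dirSum / stepScale 1 1 (1 / 2) (run f x₁ ζ n) ≤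
      objective D f x₁ - objective D f (run f x₁ ζ (n + 1)).x +
        (∑ i ∈ Finset.range (n + 1), ‖err D f (run f x₁ ζ i)‖ ^ 2 / rootSum (run f x₁ ζ i)) /
          (2 * K) +
        (K / 2 + β) * Real.log (1 + (run f x₁ ζ n).dirSum) := by
  induction n with
  | zero =>
    have h := dir_sq_div_stepScale_le hβ hK hF hL (gradSum_run_nonneg (f := f) (x₁ := x₁) ζ 0)
      (dir_sq_le_dirSum_run ζ 0)
    have e : (run f x₁ ζ 0).dirSum = ‖(run f x₁ ζ 0).dir‖ ^ 2 := rfl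
    rw [← e, sub_self, add_zero, Real.log_one, sub_zero] at h
    rw [Finset.sum_range_one]
    exact h
  | succ n ih =>
    have h := dir_sq_div_stepScale_le hβ hK hF hL
      (gradSum_run_nonneg (f := f) (x₁ := x₁) ζ (n + 1)) (dir_sq_le_dirSum_run ζ (n + 1))
    have e : (run f x₁ ζ (n + 1)).dirSum =
      (run f x₁ ζ n).dirSum + ‖(run f x₁ ζ (n + 1)).dir‖ ^ 2 := rfl
    have e2 : (run f x₁ ζ (n + 1)).dirSum - ‖(run f x₁ ζ (n + 1)).dir‖ ^ 2 =
      (run f x₁ ζ n).dirSum := by rw [e]; ring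
    have e3 : nextPoint 1 1 1 (1 / 2) (run f x₁ ζ (n + 1)) = (run f x₁ ζ (n + 1 + 1)).x :=
      (run_succ_x ζ (n + 1)).symm
    rw [e2, e3] at h
    -- The scalings increase, so the earlier sum may be divided by the newest one.
    have hb : (run f x₁ ζ n).dirSum / stepScale 1 1 (1 / 2) (run f x₁ ζ (n + 1)) ≤
        (run f x₁ ζ n).dirSum / stepScale 1 1 (1 / 2) (run f x₁ ζ n) :=
      div_le_div_of_nonneg_left (dirSum_run_nonneg ζ n)
        (zero_lt_one.trans_le (one_le_stepScale (gradSum_run_nonneg ζ n) (dirSum_run_nonneg ζ n)))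
        (stepScale_run_le_succ ζ n)
    have e4 : (run f x₁ ζ (n + 1)).dirSum / stepScale 1 1 (1 / 2) (run f x₁ ζ (n + 1)) =
        (run f x₁ ζ n).dirSum / stepScale 1 1 (1 / 2) (run f x₁ ζ (n + 1)) +
        ‖(run f x₁ ζ (n + 1)).dir‖ ^ 2 / stepScale 1 1 (1 / 2) (run f x₁ ζ (n + 1)) := by
      rw [← add_div, ← e]
    rw [Finset.sum_range_succ, add_div, e4]
    linarith

/-- Each gradient is the direction minus the error, and by monotonicity of the weights `‖ε_i‖² ≤ u_n
‖ε_i‖² / u_i`. -/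
theorem sum_gradient_sq_run_le (ζ : ℕ → Ξ) (n : ℕ) :
    ∑ i ∈ Finset.range (n + 1), ‖gradient (objective D f) (run f x₁ ζ i).x‖ ^ 2 ≤
      2 * (run f x₁ ζ n).dirSum + 2 * rootSum (run f x₁ ζ n) *
        ∑ i ∈ Finset.range (n + 1),
          ‖err D f (run f x₁ ζ i)‖ ^ 2 / rootSum (run f x₁ ζ i) := by
  rw [dirSum_run, Finset.mul_sum, Finset.mul_sum, ← Finset.sum_add_distrib]
  refine Finset.sum_le_sum fun i hi => ?_
  have hu := one_le_rootSum (gradSum_run_nonneg (f := f) (x₁ := x₁) ζ i)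
  have hui := rootSum_run_mono (f := f) (x₁ := x₁) ζ (Finset.mem_range_succ_iff.1 hi)
  simp only at hui
  set s := run f x₁ ζ i
  have h1 : ‖gradient (objective D f) s.x‖ ≤ ‖s.dir‖ + ‖err D f s‖ := by
    have : gradient (objective D f) s.x = s.dir - err D f s := by rw [err]; abel
    rw [this]; exact norm_sub_le _ _
  have h2 : ‖gradient (objective D f) s.x‖ ^ 2 ≤ 2 * ‖s.dir‖ ^ 2 + 2 * ‖err D f s‖ ^ 2 := by
    have := pow_le_pow_left₀ (norm_nonneg _) h1 2
    nlinarith [sq_nonneg (‖s.dir‖ - ‖err D f s‖)]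
  have h3 : ‖err D f s‖ ^ 2 ≤ rootSum (run f x₁ ζ n) * (‖err D f s‖ ^ 2 / rootSum s) := by
    rw [mul_div_assoc', le_div_iff₀ (by linarith), mul_comm]
    gcongr
  linarith

theorem gradSum_run_le (ζ : ℕ → Ξ) (n : ℕ) :
    (run f x₁ ζ n).gradSum ≤
      2 * ∑ i ∈ Finset.range (n + 1), ‖gradient (objective D f) (run f x₁ ζ i).x‖ ^ 2 +
      2 * ∑ i ∈ Finset.range (n + 1), ‖stochGrad f (run f x₁ ζ i).x (ζ i) -
        gradient (objective D f) (run f x₁ ζ i).x‖ ^ 2 := by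
  rw [gradSum_run, Finset.mul_sum, Finset.mul_sum, ← Finset.sum_add_distrib]
  refine Finset.sum_le_sum fun i _ => ?_
  set g := stochGrad f (run f x₁ ζ i).x (ζ i)
  set m := gradient (objective D f) (run f x₁ ζ i).x
  have h1 : ‖g‖ ≤ ‖m‖ + ‖g - m‖ := by
    have := norm_add_le m (g - m)
    rwa [add_sub_cancel] at this
  have := pow_le_pow_left₀ (norm_nonneg _) h1 2
  nlinarith [sq_nonneg (‖m‖ - ‖g - m‖)]

/-- The source space is arbitrary and only the samples up to `n` must be measurable, so the lemma
also applies to the σ-algebra generated by these samples, which gives `indepFun_run`. -/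
theorem measurable_run (hf : IsSamplingFunction D f) {α : Type*} [MeasurableSpace α]
    {ζ : ℕ → α → Ξ} (n : ℕ) (h : ∀ i ≤ n, Measurable (ζ i)) :
    Measurable fun a => run f x₁ (fun i => ζ i a) n := by
  induction n with
  | zero => exact (measurable_initState hf x₁).comp (h 0 le_rfl)
  | succ n ih =>
    exact (measurable_step hf).comp
      ((ih fun i hi => h i (hi.trans n.le_succ)).prodMk (h (n + 1) le_rfl))

variable {Ω : Type*} [MeasurableSpace Ω] {P : Measure Ω} {ζ : ℕ → Ω → Ξ}

theorem indepFun_run (hf : IsSamplingFunction D f) (hm : ∀ i, Measurable (ζ i))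
    (hi : iIndepFun ζ P) (n : ℕ) :
    IndepFun (fun ω => run f x₁ (fun i => ζ i ω) n) (ζ (n + 1)) P := by
  have h := indep_iSup_of_disjoint (m := fun i => MeasurableSpace.comap (ζ i) inferInstance)
    (fun i => (hm i).comap_le) hi.iIndep (S := Set.Iic n) (T := {n + 1})
    (by simp)
  rw [IndepFun_iff_Indep]
  refine indep_of_indep_of_le_left (indep_of_indep_of_le_right h ?_) ?_
  · simp
  · refine Measurable.comap_le ?_
    refine @measurable_run _ _ _ _ _ _ hf _ (_) _ n fun i hin => ?_
    refine Measurable.mono (comap_measurable (ζ i)) ?_ le_rfl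
    exact le_iSup₂_of_le (f := fun i (_ : i ∈ Set.Iic n) =>
      MeasurableSpace.comap (ζ i) inferInstance) i hin le_rfl

end

/-! ### Expectations along a run, and the averaging step -/

section

variable {d : ℕ} {Ξ : Type*} [MeasurableSpace Ξ] {D : Measure Ξ}
  {f : EuclideanSpace ℝ (Fin d) → Ξ → ℝ} {x₁ : EuclideanSpace ℝ (Fin d)} {σ β G : ℝ}
  {Ω : Type*} [MeasurableSpace Ω] {P : Measure Ω} {ζ : ℕ → Ω → Ξ}

theorem ae_forall_norm_stochGrad_le (hb : BoundedStochGrad D f G) (hm : ∀ i, Measurable (ζ i))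
    (hD : ∀ i, P.map (ζ i) = D) : ∀ᵐ ω ∂P, ∀ i x, ‖stochGrad f x (ζ i ω)‖ ≤ G := by
  rw [ae_all_iff]
  intro i
  have h := hb
  rw [BoundedStochGrad, ← hD i] at h
  exact ae_of_ae_map (hm i).aemeasurable h

theorem integral_stochGrad_sub_sq_init_le (hf : IsSamplingFunction D f)
    (hu : UnbiasedBoundedVariance D f σ) (hm : ∀ i, Measurable (ζ i))
    (hD : ∀ i, P.map (ζ i) = D) :
    ∫ ω, ‖stochGrad f x₁ (ζ 0 ω) - gradient (objective D f) x₁‖ ^ 2 ∂P ≤ σ ^ 2 := by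
  have hgx : Measurable (stochGrad f x₁) :=
    (measurable_stochGrad hf).comp (measurable_const.prodMk measurable_id)
  have h := (hu x₁).2.2.2
  rw [← hD 0, integral_map (hm 0).aemeasurable
    ((hgx.sub_const _).norm.pow_const 2).aestronglyMeasurable] at h
  rwa [hD 0] at h

/-- Split over the events `τ = t`; on each, independence factors the indicator, of mean `1 / T`, out
of the expectation. -/
theorem integral_uniform_index {S : Type*} [MeasurableSpace S] {X : Ω → S} {τ : Ω → ℕ} {T : ℕ}
    (hτ : Measurable τ) (hT : P.map τ = uniformOn (Set.Icc 1 T))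
    (hind : IndepFun τ X P) {k : ℕ → S → ℝ} (hk : ∀ t, Measurable (k t))
    (hi : ∀ t, Integrable (fun ω => k t (X ω)) P) :
    Integrable (fun ω => k (τ ω) (X ω)) P ∧
      ∫ ω, k (τ ω) (X ω) ∂P =
        ∑ t ∈ Finset.Icc 1 T, (1 / (T : ℝ)) * ∫ ω, k t (X ω) ∂P := by
  have hcount : Measure.count (Set.Icc 1 T) = T := by
    rw [← Finset.coe_Icc, Measure.count_apply_finset]; simp
  have hpt : ∀ t ∈ Finset.Icc 1 T, P.real (τ ⁻¹' {t}) = 1 / T := by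
    intro t ht
    rw [Measure.real, ← Measure.map_apply hτ (measurableSet_singleton t), hT, uniformOn,
      cond_apply measurableSet_Icc, hcount,
      Set.inter_eq_self_of_subset_right (by simpa using ht), Measure.count_singleton]
    simp
  have hsupp : ∀ᵐ ω ∂P, τ ω ∈ Finset.Icc 1 T := by
    have : ∀ᵐ t ∂(P.map τ), t ∈ Finset.Icc 1 T := by
      rw [hT, uniformOn]
      refine (ae_cond_mem measurableSet_Icc).mono fun t ht => ?_
      simpa using ht
    exact ae_of_ae_map hτ.aemeasurable this
  have hmeas : ∀ t, MeasurableSet (τ ⁻¹' {t}) := fun t => hτ (measurableSet_singleton t)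
  have hsum : (fun ω => k (τ ω) (X ω)) =ᵐ[P] fun ω => ∑ t ∈ Finset.Icc 1 T,
      (τ ⁻¹' {t}).indicator (fun ω => k t (X ω)) ω := by
    filter_upwards [hsupp] with ω hω
    rw [Finset.sum_eq_single_of_mem (τ ω) hω]
    · rw [Set.indicator_of_mem (by simp)]
    · intro t _ hne
      exact Set.indicator_of_notMem (by simpa using hne.symm) _
  have hind' : ∀ t, Integrable ((τ ⁻¹' {t}).indicator fun ω => k t (X ω)) P :=
    fun t => (hi t).indicator (hmeas t)
  refine ⟨(integrable_finsetSum _ fun t _ => hind' t).congr hsum.symm, ?_⟩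
  rw [integral_congr_ae hsum, integral_finsetSum _ fun t _ => hind' t]
  refine Finset.sum_congr rfl fun t ht => ?_
  have h1 : IndepFun (fun ω => Set.indicator {t} (1 : ℕ → ℝ) (τ ω)) (fun ω => k t (X ω)) P :=
    hind.comp (measurable_one.indicator (measurableSet_singleton t)) (hk t)
  have h2 := h1.integral_fun_mul_eq_mul_integral
    (((measurable_one.indicator (measurableSet_singleton t)).comp hτ).aestronglyMeasurable)
    (hi t).aestronglyMeasurable
  have h3 : ∫ ω, Set.indicator {t} (1 : ℕ → ℝ) (τ ω) ∂P = 1 / T := by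
    rw [← hpt t ht, ← integral_indicator_one (hmeas t)]
    rfl
  rw [← h3, ← h2]
  refine integral_congr_ae (Filter.Eventually.of_forall fun ω => ?_)
  by_cases h : τ ω = t <;> simp [Set.indicator, h]

theorem exists_ae_stateBound_run (hb : BoundedStochGrad D f G) (hm : ∀ i, Measurable (ζ i))
    (hD : ∀ i, P.map (ζ i) = D) (x₁ : EuclideanSpace ℝ (Fin d)) (n : ℕ) :
    ∃ M, ∀ᵐ ω ∂P, StateBound M (run f x₁ (fun i => ζ i ω) n) := by
  obtain ⟨M, hM⟩ := exists_stateBound_run f x₁ G n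
  exact ⟨M, (ae_forall_norm_stochGrad_le hb hm hD).mono fun ω h => hM _ h⟩

theorem integrable_comp_run [IsFiniteMeasure P] (hf : IsSamplingFunction D f)
    (hb : BoundedStochGrad D f G) (hm : ∀ i, Measurable (ζ i)) (hD : ∀ i, P.map (ζ i) = D)
    (n : ℕ) {φ : State d → ℝ} (hφ : Measurable φ)
    (hC : ∀ M, ∃ C, ∀ s, StateBound M s → |φ s| ≤ C) :
    Integrable (fun ω => φ (run f x₁ (fun i => ζ i ω) n)) P := by
  obtain ⟨M, hM⟩ := exists_ae_stateBound_run hb hm hD x₁ n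
  obtain ⟨C, hC⟩ := hC M
  exact integrable_of_stateBound (measurable_run hf n fun i _ => hm i) hM hφ hC

theorem integrable_gradSum_run [IsFiniteMeasure P] (hf : IsSamplingFunction D f)
    (hb : BoundedStochGrad D f G) (hm : ∀ i, Measurable (ζ i)) (hD : ∀ i, P.map (ζ i) = D)
    (n : ℕ) : Integrable (fun ω => (run f x₁ (fun i => ζ i ω) n).gradSum) P :=
  integrable_comp_run hf hb hm hD n measurable_gradSum fun M =>
    ⟨M, fun s h => by rw [abs_of_nonneg h.gradSum_nonneg]; exact h.gradSum_le⟩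

theorem integrable_dirSum_run [IsFiniteMeasure P] (hf : IsSamplingFunction D f)
    (hb : BoundedStochGrad D f G) (hm : ∀ i, Measurable (ζ i)) (hD : ∀ i, P.map (ζ i) = D)
    (n : ℕ) : Integrable (fun ω => (run f x₁ (fun i => ζ i ω) n).dirSum) P :=
  integrable_comp_run hf hb hm hD n measurable_dirSum fun M =>
    ⟨M, fun s h => by rw [abs_of_nonneg h.dirSum_nonneg]; exact h.dirSum_le⟩

variable [IsProbabilityMeasure D] [IsProbabilityMeasure P]

theorem integrable_stochGrad_sub_sq_run (hβ : 0 ≤ β) (hf : IsSamplingFunction D f)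
    (hu : UnbiasedBoundedVariance D f σ) (hs : AveragedSmooth D f β)
    (hb : BoundedStochGrad D f G) (hm : ∀ i, Measurable (ζ i)) (hD : ∀ i, P.map (ζ i) = D)
    (n : ℕ) :
    Integrable (fun ω => ‖stochGrad f (run f x₁ (fun i => ζ i ω) n).x (ζ n ω) -
      gradient (objective D f) (run f x₁ (fun i => ζ i ω) n).x‖ ^ 2) P := by
  have hmg := measurable_gradient_objective hβ hu hs
  have hx := measurable_x.comp (measurable_run (x₁ := x₁) hf n fun i _ => hm i)
  have h1 := (measurable_stochGrad hf).comp (hx.prodMk (hm n))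
  refine Integrable.of_bound ((h1.sub (hmg.comp hx)).norm.pow_const 2).aestronglyMeasurable
    ((G + G) ^ 2) ((ae_forall_norm_stochGrad_le hb hm hD).mono fun ω h => ?_)
  rw [Real.norm_of_nonneg (by positivity)]
  exact pow_le_pow_left₀ (norm_nonneg _) ((norm_sub_le _ _).trans
    (add_le_add (h n _) (norm_gradient_objective_le hu hb _))) 2

theorem integral_stochGrad_sub_sq_run_le (hβ : 0 ≤ β) (hf : IsSamplingFunction D f)
    (hu : UnbiasedBoundedVariance D f σ) (hs : AveragedSmooth D f β)
    (hb : BoundedStochGrad D f G) (hm : ∀ i, Measurable (ζ i)) (hD : ∀ i, P.map (ζ i) = D)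
    (hi : iIndepFun ζ P) (n : ℕ) :
    ∫ ω, ‖stochGrad f (run f x₁ (fun i => ζ i ω) n).x (ζ n ω) -
      gradient (objective D f) (run f x₁ (fun i => ζ i ω) n).x‖ ^ 2 ∂P ≤ σ ^ 2 := by
  cases n with
  | zero => exact integral_stochGrad_sub_sq_init_le hf hu hm hD
  | succ n =>
    have hmg := measurable_gradient_objective hβ hu hs
    have hy : Measurable (fun p : State d × Ξ => nextPoint 1 1 1 (1 / 2) p.1) :=
      measurable_nextPoint.comp measurable_fst
    have hφ : Measurable fun p : State d × Ξ =>
        ‖stochGrad f (nextPoint 1 1 1 (1 / 2) p.1) p.2 -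
          gradient (objective D f) (nextPoint 1 1 1 (1 / 2) p.1)‖ ^ 2 :=
      (((measurable_stochGrad hf).comp (hy.prodMk measurable_snd)).sub
        (hmg.comp hy)).norm.pow_const 2
    have hint := integrable_stochGrad_sub_sq_run (x₁ := x₁) hβ hf hu hs hb hm hD (n + 1)
    simp only [run_succ_x] at hint ⊢
    have h := integral_comp_le_of_indepFun (D := D)
      (measurable_run (x₁ := x₁) hf n fun i _ => hm i)
      (hm (n + 1)) (indepFun_run hf hm hi n) (hD (n + 1)) hφ
      hint (ψ := fun _ : State d => σ ^ 2) (integrable_const _)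
      (Filter.Eventually.of_forall fun ω =>
        (hu (nextPoint 1 1 1 (1 / 2) (run f x₁ (fun i => ζ i ω) n))).2.2.2)
    simp only [integral_const, probReal_univ, one_smul] at h
    exact h

theorem integrable_err_sq_run (hβ : 0 ≤ β) (hf : IsSamplingFunction D f)
    (hu : UnbiasedBoundedVariance D f σ) (hs : AveragedSmooth D f β)
    (hb : BoundedStochGrad D f G) (hm : ∀ i, Measurable (ζ i)) (hD : ∀ i, P.map (ζ i) = D)
    (n : ℕ) : Integrable (fun ω => ‖err D f (run f x₁ (fun i => ζ i ω) n)‖ ^ 2) P :=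
  integrable_comp_run hf hb hm hD n
    ((measurable_err (measurable_gradient_objective hβ hu hs)).norm.pow_const 2) fun M =>
    ⟨(M + G) ^ 2, fun s h => by
      rw [abs_of_nonneg (by positivity)]
      exact pow_le_pow_left₀ (norm_nonneg _) (norm_err_le (norm_gradient_objective_le hu hb) h) 2⟩

theorem integrable_err_sq_div_run (hβ : 0 ≤ β) (hf : IsSamplingFunction D f)
    (hu : UnbiasedBoundedVariance D f σ) (hs : AveragedSmooth D f β)
    (hb : BoundedStochGrad D f G) (hm : ∀ i, Measurable (ζ i)) (hD : ∀ i, P.map (ζ i) = D)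
    (n : ℕ) : Integrable (fun ω => ‖err D f (run f x₁ (fun i => ζ i ω) n)‖ ^ 2 /
      rootSum (run f x₁ (fun i => ζ i ω) n)) P :=
  integrable_comp_run hf hb hm hD n (φ := fun s => ‖err D f s‖ ^ 2 / rootSum s)
    (((measurable_err (measurable_gradient_objective hβ hu hs)).norm.pow_const 2).div
      measurable_rootSum) fun M =>
    ⟨(M + G) ^ 2, fun s h => by
      have hu1 := one_le_rootSum h.gradSum_nonneg
      rw [abs_of_nonneg (by positivity)]
      exact (div_le_self (by positivity) hu1).trans
        (pow_le_pow_left₀ (norm_nonneg _) (norm_err_le (norm_gradient_objective_le hu hb) h) 2)⟩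

theorem integrable_potential_run (hβ : 0 ≤ β) (hf : IsSamplingFunction D f)
    (hu : UnbiasedBoundedVariance D f σ) (hs : AveragedSmooth D f β)
    (hb : BoundedStochGrad D f G) (hm : ∀ i, Measurable (ζ i)) (hD : ∀ i, P.map (ζ i) = D)
    (n : ℕ) : Integrable (fun ω => potential D f β G (run f x₁ (fun i => ζ i ω) n)) P :=
  integrable_comp_run hf hb hm hD n
    (measurable_potential (measurable_gradient_objective hβ hu hs)) fun _ =>
    ⟨_, fun _ h => abs_potential_le (norm_gradient_objective_le hu hb) h⟩

theorem sum_integral_err_sq_le_potential (hβ : 0 ≤ β) (hf : IsSamplingFunction D f)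
    (hu : UnbiasedBoundedVariance D f σ) (hs : AveragedSmooth D f β)
    (hb : BoundedStochGrad D f G) (hm : ∀ i, Measurable (ζ i)) (hD : ∀ i, P.map (ζ i) = D)
    (hi : iIndepFun ζ P) (n : ℕ) :
    (∑ i ∈ Finset.range n, ∫ ω, ‖err D f (run f x₁ (fun i => ζ i ω) i)‖ ^ 2 /
        rootSum (run f x₁ (fun i => ζ i ω) i) ∂P) +
      ∫ ω, potential D f β G (run f x₁ (fun i => ζ i ω) n) ∂P ≤
    ∫ ω, potential D f β G (run f x₁ (fun i => ζ i ω) 0) ∂P := by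
  induction n with
  | zero => simp
  | succ n ih =>
    obtain ⟨M, hM⟩ := exists_ae_stateBound_run hb hm hD x₁ n
    have iP := integrable_potential_run (x₁ := x₁) hβ hf hu hs hb hm hD
    have iE := integrable_err_sq_div_run (x₁ := x₁) hβ hf hu hs hb hm hD n
    have h := integral_comp_le_of_indepFun (D := D)
      (measurable_run (x₁ := x₁) hf n fun i _ => hm i)
      (hm (n + 1)) (indepFun_run hf hm hi n) (hD (n + 1))
      (φ := fun p => potential D f β G (step 1 1 1 (1 / 2) f p.1 p.2))
      ((measurable_potential (measurable_gradient_objective hβ hu hs)).comp (measurable_step hf))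
      (iP (n + 1)) (ψ := fun s => potential D f β G s - ‖err D f s‖ ^ 2 / rootSum s)
      ((iP n).sub iE)
      (hM.mono fun ω h => integral_potential_step_le hβ hf hu hs hb h)
    rw [integral_sub (iP n) iE] at h
    rw [Finset.sum_range_succ]
    have e : ∫ ω, potential D f β G (run f x₁ (fun i => ζ i ω) (n + 1)) ∂P =
      ∫ ω, potential D f β G (step 1 1 1 (1 / 2) f (run f x₁ (fun i => ζ i ω) n)
        (ζ (n + 1) ω)) ∂P := rfl
    linarith

theorem integral_potential_init_le (hβ : 0 ≤ β) (hf : IsSamplingFunction D f)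
    (hu : UnbiasedBoundedVariance D f σ) (hs : AveragedSmooth D f β)
    (hb : BoundedStochGrad D f G) (hm : ∀ i, Measurable (ζ i)) (hD : ∀ i, P.map (ζ i) = D) :
    ∫ ω, potential D f β G (run f x₁ (fun i => ζ i ω) 0) ∂P ≤
      (1 + G ^ 2) * σ ^ 2 + 2 * (1 + G ^ 2) * G ^ 2 := by
  have iE := integrable_err_sq_run (x₁ := x₁) hβ hf hu hs hb hm hD 0
  have hσ := integral_stochGrad_sub_sq_init_le (x₁ := x₁) hf hu hm hD
  have h1 : ∫ ω, potential D f β G (run f x₁ (fun i => ζ i ω) 0) ∂P ≤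
      ∫ ω, ((1 + G ^ 2) * ‖err D f (run f x₁ (fun i => ζ i ω) 0)‖ ^ 2 +
        2 * (1 + G ^ 2) * G ^ 2) ∂P := by
    refine integral_mono_ae (integrable_potential_run hβ hf hu hs hb hm hD 0)
      ((iE.const_mul _).add (integrable_const _))
      ((ae_forall_norm_stochGrad_le hb hm hD).mono fun ω h => ?_)
    have h0 := gradSum_run_nonneg (f := f) (x₁ := x₁) (fun i => ζ i ω) 0
    have hu1 := one_le_rootSum h0
    have hu3 := rootSum_pow h0
    have hg : (run f x₁ (fun i => ζ i ω) 0).gradSum ≤ G ^ 2 :=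
      pow_le_pow_left₀ (norm_nonneg _) (h 0 x₁) 2
    have hd : (run f x₁ (fun i => ζ i ω) 0).dirSum -
      ‖(run f x₁ (fun i => ζ i ω) 0).dir‖ ^ 2 = 0 := sub_self _
    simp only [potential, hd, add_zero, Real.log_one, mul_zero, zero_add]
    set s := run f x₁ (fun i => ζ i ω) 0
    have hlog : 0 ≤ Real.log (1 + s.gradSum) := Real.log_nonneg (by linarith)
    have hdiv : G ^ 2 / (1 + s.gradSum) ≤ G ^ 2 := div_le_self (sq_nonneg _) (by linarith)
    -- Bernoulli's inequality `3 (u - 1) ≤ u³ - 1 ≤ G²` gives `u ≤ 1 + G²/3`.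
    have huG : rootSum s + G ^ 2 / 3 ≤ 1 + G ^ 2 := by
      have : 3 * (rootSum s - 1) ≤ rootSum s ^ 3 - 1 := by
        nlinarith [mul_nonneg (show 0 ≤ rootSum s - 1 by linarith)
          (show 0 ≤ rootSum s - 1 by linarith), mul_nonneg (mul_nonneg
          (show 0 ≤ rootSum s - 1 by linarith) (show 0 ≤ rootSum s - 1 by linarith))
          (show 0 ≤ rootSum s by linarith)]
      nlinarith
    have h2 := mul_le_mul_of_nonneg_right huG (sq_nonneg ‖err D f s‖)
    have h3 : (1 + G ^ 2) * (G ^ 2 / (1 + s.gradSum) - Real.log (1 + s.gradSum)) ≤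
        (1 + G ^ 2) * G ^ 2 := by
      gcongr; linarith
    linarith
  rw [integral_add (iE.const_mul _) (integrable_const _), integral_const_mul] at h1
  simp only [integral_const, probReal_univ, one_smul] at h1
  have e : ∫ ω, ‖err D f (run f x₁ (fun i => ζ i ω) 0)‖ ^ 2 ∂P =
    ∫ ω, ‖stochGrad f x₁ (ζ 0 ω) - gradient (objective D f) x₁‖ ^ 2 ∂P := rfl
  rw [e] at h1
  have := mul_le_mul_of_nonneg_left hσ (show 0 ≤ 1 + G ^ 2 by positivity)
  linarith

theorem le_integral_potential_run_succ (hβ : 0 ≤ β) (hf : IsSamplingFunction D f)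
    (hu : UnbiasedBoundedVariance D f σ) (hs : AveragedSmooth D f β)
    (hb : BoundedStochGrad D f G) (hm : ∀ i, Measurable (ζ i)) (hD : ∀ i, P.map (ζ i) = D)
    (n : ℕ) :
    -(2 * (1 + G ^ 2) * (β ^ 2 * ∫ ω, Real.log (1 + (run f x₁ (fun i => ζ i ω) n).dirSum) ∂P +
      ∫ ω, Real.log (1 + (run f x₁ (fun i => ζ i ω) n).gradSum) ∂P + G ^ 2)) ≤
    ∫ ω, potential D f β G (run f x₁ (fun i => ζ i ω) (n + 1)) ∂P := by
  have i1 := integrable_log_one_add (integrable_dirSum_run (x₁ := x₁) hf hb hm hD n)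
    (fun ω => dirSum_run_nonneg _ n)
  have i2 := integrable_log_one_add (integrable_gradSum_run (x₁ := x₁) hf hb hm hD n)
    (fun ω => gradSum_run_nonneg _ n)
  have i3 : Integrable (fun ω => β ^ 2 * Real.log (1 + (run f x₁ (fun i => ζ i ω) n).dirSum) +
      Real.log (1 + (run f x₁ (fun i => ζ i ω) n).gradSum)) P := (i1.const_mul _).add i2
  have i4 : Integrable (fun ω => β ^ 2 * Real.log (1 + (run f x₁ (fun i => ζ i ω) n).dirSum) +
      Real.log (1 + (run f x₁ (fun i => ζ i ω) n).gradSum) + G ^ 2) P :=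
    i3.add (integrable_const _)
  have h : ∫ ω, -(2 * (1 + G ^ 2) *
      (β ^ 2 * Real.log (1 + (run f x₁ (fun i => ζ i ω) n).dirSum) +
      Real.log (1 + (run f x₁ (fun i => ζ i ω) n).gradSum) + G ^ 2)) ∂P ≤
      ∫ ω, potential D f β G (run f x₁ (fun i => ζ i ω) (n + 1)) ∂P := by
    refine integral_mono_ae (i4.const_mul _).neg
      (integrable_potential_run hβ hf hu hs hb hm hD (n + 1))
      ((ae_forall_norm_stochGrad_le hb hm hD).mono fun ω h => ?_)
    have h0 := gradSum_run_nonneg (f := f) (x₁ := x₁) (fun i => ζ i ω) n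
    have h0' := gradSum_run_nonneg (f := f) (x₁ := x₁) (fun i => ζ i ω) (n + 1)
    have hu1 := one_le_rootSum h0'
    have hg : (run f x₁ (fun i => ζ i ω) (n + 1)).gradSum ≤
        (run f x₁ (fun i => ζ i ω) n).gradSum + G ^ 2 :=
      add_le_add_right (pow_le_pow_left₀ (norm_nonneg _) (h (n + 1) _) 2) _
    have hd : (run f x₁ (fun i => ζ i ω) (n + 1)).dirSum -
        ‖(run f x₁ (fun i => ζ i ω) (n + 1)).dir‖ ^ 2 =
        (run f x₁ (fun i => ζ i ω) n).dirSum := add_sub_cancel_right _ _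
    simp only [potential, hd]
    set s := run f x₁ (fun i => ζ i ω) n
    set s' := run f x₁ (fun i => ζ i ω) (n + 1)
    -- The potential is taken one step beyond the horizon; the extra gradient is removed here at the
    -- cost of `G²`. With the equal cost at the initial state this makes the `4 G²` of the final
    -- bound.
    have hlog : Real.log (1 + s'.gradSum) ≤ Real.log (1 + s.gradSum) + G ^ 2 := by
      have h1 := Real.log_le_sub_one_of_pos
        (div_pos (show 0 < 1 + s'.gradSum by linarith) (show 0 < 1 + s.gradSum by linarith))
      rw [Real.log_div (by linarith) (by linarith)] at h1
      have h2 : (1 + s'.gradSum) / (1 + s.gradSum) ≤ 1 + G ^ 2 := by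
        rw [div_le_iff₀ (by linarith)]
        nlinarith [sq_nonneg G]
      linarith
    have hdiv : 0 ≤ G ^ 2 / (1 + s'.gradSum) := div_nonneg (sq_nonneg _) (by linarith)
    have h2 : 0 ≤ (rootSum s' + G ^ 2 / 3) * ‖err D f s'‖ ^ 2 := by positivity
    have h3 : (1 + G ^ 2) * (β ^ 2 * Real.log (1 + s.dirSum) + Real.log (1 + s'.gradSum) -
        G ^ 2 / (1 + s'.gradSum)) ≤
        (1 + G ^ 2) * (β ^ 2 * Real.log (1 + s.dirSum) + Real.log (1 + s.gradSum) + G ^ 2) := by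
      apply mul_le_mul_of_nonneg_left _ (by positivity)
      linarith
    linarith
  rw [integral_neg, integral_const_mul, integral_add i3 (integrable_const _),
    integral_add (i1.const_mul _) i2, integral_const_mul] at h
  simpa only [integral_const, probReal_univ, one_smul] using h

theorem integral_sum_err_sq_run_le (hβ : 0 ≤ β) (hf : IsSamplingFunction D f)
    (hu : UnbiasedBoundedVariance D f σ) (hs : AveragedSmooth D f β)
    (hb : BoundedStochGrad D f G) (hm : ∀ i, Measurable (ζ i)) (hD : ∀ i, P.map (ζ i) = D)
    (hi : iIndepFun ζ P) (n : ℕ) :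
    ∫ ω, ∑ i ∈ Finset.range (n + 1), ‖err D f (run f x₁ (fun i => ζ i ω) i)‖ ^ 2 /
        rootSum (run f x₁ (fun i => ζ i ω) i) ∂P ≤
      (1 + G ^ 2) * (σ ^ 2 + 4 * G ^ 2 +
        2 * β ^ 2 * ∫ ω, Real.log (1 + (run f x₁ (fun i => ζ i ω) n).dirSum) ∂P +
        2 * ∫ ω, Real.log (1 + (run f x₁ (fun i => ζ i ω) n).gradSum) ∂P) := by
  rw [integral_finsetSum _ fun i _ => integrable_err_sq_div_run hβ hf hu hs hb hm hD i]
  have h1 := sum_integral_err_sq_le_potential (x₁ := x₁) hβ hf hu hs hb hm hD hi (n + 1)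
  have h2 := integral_potential_init_le (x₁ := x₁) hβ hf hu hs hb hm hD
  have h3 := le_integral_potential_run_succ (x₁ := x₁) hβ hf hu hs hb hm hD n
  linarith

theorem integrable_sum_gradient_sq_run (hβ : 0 ≤ β) (hf : IsSamplingFunction D f)
    (hu : UnbiasedBoundedVariance D f σ) (hs : AveragedSmooth D f β)
    (hb : BoundedStochGrad D f G) (hm : ∀ i, Measurable (ζ i)) (n : ℕ) :
    Integrable (fun ω => ∑ i ∈ Finset.range n,
      ‖gradient (objective D f) (run f x₁ (fun i => ζ i ω) i).x‖ ^ 2) P := by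
  refine integrable_finsetSum _ fun i _ => ?_
  have hx := measurable_x.comp (measurable_run (x₁ := x₁) hf i fun i _ => hm i)
  refine Integrable.of_bound (((measurable_gradient_objective hβ hu hs).comp
    hx).norm.pow_const 2).aestronglyMeasurable (G ^ 2) (Filter.Eventually.of_forall fun ω => ?_)
  rw [Real.norm_of_nonneg (by positivity)]
  exact pow_le_pow_left₀ (norm_nonneg _) (norm_gradient_objective_le hu hb _) 2

/-- The rate for the cube root of the sum of the squared gradient norms along a run. -/
theorem integral_sum_gradient_sq_rpow_run_le (hσ : 0 ≤ σ) (hβ : 0 ≤ β) (hG : 0 ≤ G)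
    (hf : IsSamplingFunction D f) (hlow : LowerBounded D f)
    (hu : UnbiasedBoundedVariance D f σ) (hs : AveragedSmooth D f β)
    (hb : BoundedStochGrad D f G) (hm : ∀ i, Measurable (ζ i)) (hD : ∀ i, P.map (ζ i) = D)
    (hi : iIndepFun ζ P) {T : ℕ} (hT : 1 ≤ T) :
    (∫ ω, (∑ i ∈ Finset.range T,
      ‖gradient (objective D f) (run f x₁ (fun i => ζ i ω) i).x‖ ^ 2) ^ (1 / 3 : ℝ) ∂P) /
        (T : ℝ) ^ (1 / 3 : ℝ) ≤
      10 ^ 5 * rate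
        (2 * 10 ^ 10 * orderW₁ (objective D f x₁ - ⨅ x, objective D f x) σ G β)
        (2 * 10 ^ 10 * orderW₂ (objective D f x₁ - ⨅ x, objective D f x) σ G β)
        (1 * orderW₃ G β) σ T := by
  obtain ⟨n, rfl⟩ : ∃ n, T = n + 1 := ⟨T - 1, by omega⟩
  have hΔ : 0 ≤ objective D f x₁ - ⨅ x, objective D f x := sub_nonneg.2 (ciInf_le hlow x₁)
  have hL := norm_gradient_objective_sub_le hβ hu hs
  have hb1 : 1 ≤ betaMax β := le_max_right _ _
  have hK : 0 < betaMax β * (1 + G ^ 2) := by positivity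
  have hq0 : 0 ≤ ∫ ω, (1 + (run f x₁ (fun i => ζ i ω) n).dirSum) ^ (1 / 3 : ℝ) ∂P :=
    integral_nonneg fun ω => Real.rpow_nonneg
      (by linarith [dirSum_run_nonneg (f := f) (x₁ := x₁) (fun i => ζ i ω) n]) _
  have hh0 : 0 ≤ ∫ ω, (∑ i ∈ Finset.range (n + 1),
      ‖gradient (objective D f) (run f x₁ (fun i => ζ i ω) i).x‖ ^ 2) ^ (1 / 3 : ℝ) ∂P :=
    integral_nonneg fun ω => Real.rpow_nonneg (Finset.sum_nonneg fun i _ => sq_nonneg _) _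
  -- The self-bounding quantity also contains the nonnegative direction moment, which is dropped
  -- here.
  refine le_trans ?_ (le_rate_of_selfBound hΔ hσ hG hT (add_nonneg hh0 hq0) ?_)
  · gcongr
    linarith
  · intro l hl
    refine selfBound_of_moments (P := P)
      (Dv := fun ω => (run f x₁ (fun i => ζ i ω) n).dirSum)
      (Gv := fun ω => (run f x₁ (fun i => ζ i ω) n).gradSum)
      (Ev := fun ω => ∑ i ∈ Finset.range (n + 1), ‖err D f (run f x₁ (fun i => ζ i ω) i)‖ ^ 2 /
        rootSum (run f x₁ (fun i => ζ i ω) i))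
      (Hv := fun ω => ∑ i ∈ Finset.range (n + 1),
        ‖gradient (objective D f) (run f x₁ (fun i => ζ i ω) i).x‖ ^ 2)
      (Nv := fun ω => ∑ i ∈ Finset.range (n + 1),
        ‖stochGrad f (run f x₁ (fun i => ζ i ω) i).x (ζ i ω) -
          gradient (objective D f) (run f x₁ (fun i => ζ i ω) i).x‖ ^ 2)
      hΔ hβ (by positivity) (integrable_dirSum_run hf hb hm hD n)
      (integrable_gradSum_run hf hb hm hD n)
      (integrable_finsetSum _ fun i _ => integrable_err_sq_div_run hβ hf hu hs hb hm hD i)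
      (integrable_sum_gradient_sq_run hβ hf hu hs hb hm (n + 1))
      (integrable_finsetSum _ fun i _ =>
        integrable_stochGrad_sub_sq_run hβ hf hu hs hb hm hD i)
      (fun ω => dirSum_run_nonneg _ n) (fun ω => gradSum_run_nonneg _ n)
      (fun ω => Finset.sum_nonneg fun i _ => div_nonneg (sq_nonneg _)
        (zero_le_one.trans (one_le_rootSum (gradSum_run_nonneg _ i))))
      (fun ω => Finset.sum_nonneg fun i _ => sq_nonneg _)
      (fun ω => Finset.sum_nonneg fun i _ => sq_nonneg _)
      (integral_sum_err_sq_run_le hβ hf hu hs hb hm hD hi n) ?_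
      (fun ω => sum_gradient_sq_run_le _ n) (fun ω => gradSum_run_le _ n) ?_ rfl l hl
    · intro ω
      have h := dirSum_div_stepScale_run_le (x₁ := x₁) hβ hK hf.differentiable_objective hL
        (fun i => ζ i ω) n
      rw [stepScale_eq (gradSum_run_nonneg _ n)] at h
      have hinf : ⨅ x, objective D f x ≤
        objective D f (run f x₁ (fun i => ζ i ω) (n + 1)).x := ciInf_le hlow _
      refine h.trans ?_
      gcongr
    · rw [integral_finsetSum _ fun i _ => integrable_stochGrad_sub_sq_run hβ hf hu hs hb hm hD i,
        rpow_third_pow (by positivity)]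
      refine (Finset.sum_le_sum fun i _ =>
        integral_stochGrad_sub_sq_run_le hβ hf hu hs hb hm hD hi i).trans_eq ?_
      rw [Finset.sum_const, Finset.card_range, nsmul_eq_mul, mul_comm]

/-- Jensen's inequality for the concave cube root, since `z^(2/3) = (z²)^(1/3)`. -/
theorem mean_rpow_two_thirds_le {T : ℕ} (hT : 1 ≤ T) {z : ℕ → ℝ} (hz : ∀ i, 0 ≤ z i) :
    ∑ i ∈ Finset.range T, (1 / (T : ℝ)) * z i ^ (2 / 3 : ℝ) ≤
      (∑ i ∈ Finset.range T, z i ^ 2) ^ (1 / 3 : ℝ) / (T : ℝ) ^ (1 / 3 : ℝ) := by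
  have hT0 : (0:ℝ) < T := by exact_mod_cast hT
  have h := (Real.concaveOn_rpow (p := (1 / 3 : ℝ)) (by norm_num) (by norm_num)).le_map_sum
    (t := Finset.range T) (w := fun _ => 1 / (T : ℝ)) (p := fun i => z i ^ 2)
    (fun _ _ => by positivity) (by simp [hT0.ne']) (fun i _ => sq_nonneg (z i))
  simp only [smul_eq_mul, ← Finset.mul_sum] at h
  rw [← Finset.mul_sum, ← Real.div_rpow (Finset.sum_nonneg fun i _ => sq_nonneg _) hT0.le,
    div_eq_mul_one_div (∑ i ∈ Finset.range T, z i ^ 2), mul_comm _ (1 / (T : ℝ))]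
  refine le_trans (le_of_eq ?_) h
  congr 1
  refine Finset.sum_congr rfl fun i _ => ?_
  rw [← Real.rpow_natCast, ← Real.rpow_mul (hz i)]
  norm_num

end

end MetaStorm

end

/-! ### The uniformly chosen output -/

theorem theorem1 :
    ∃ C C₁ C₂ C₃ : ℝ, 0 < C ∧ 0 < C₁ ∧ 0 < C₂ ∧ 0 < C₃ ∧
      ∀ (d : ℕ) (Ξ : Type*) [MeasurableSpace Ξ] (D : Measure Ξ) [IsProbabilityMeasure D]
        (f : EuclideanSpace ℝ (Fin d) → Ξ → ℝ) (σ β G : ℝ),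
        0 ≤ σ → 0 ≤ β → 0 ≤ G →
        MetaStorm.IsSamplingFunction D f →
        MetaStorm.LowerBounded D f →
        MetaStorm.UnbiasedBoundedVariance D f σ →
        MetaStorm.AveragedSmooth D f β →
        MetaStorm.BoundedStochGrad D f G →
        ∀ (x₁ : EuclideanSpace ℝ (Fin d)) (T : ℕ), 1 ≤ T →
        ∀ (Ω : Type*) [MeasurableSpace Ω] (P : Measure Ω) [IsProbabilityMeasure P]
          (ξ : ℕ → Ω → Ξ) (τ : Ω → ℕ),
          -- the samples are independent with law `D`
          (∀ t, Measurable (ξ t)) → (∀ t, P.map (ξ t) = D) → iIndepFun ξ P →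
          -- the output index is uniform on `{1, …, T}`, independently of the samples
          Measurable τ → P.map τ = uniformOn (Set.Icc 1 T) → IndepFun τ (fun ω t => ξ t ω) P →
          Integrable (fun ω => ‖gradient (MetaStorm.objective D f)
              (MetaStorm.iterate 1 1 1 (1 / 2) f x₁ (fun t => ξ t ω) (τ ω))‖ ^ (2 / 3 : ℝ)) P ∧
          ∫ ω, ‖gradient (MetaStorm.objective D f)
              (MetaStorm.iterate 1 1 1 (1 / 2) f x₁ (fun t => ξ t ω) (τ ω))‖ ^ (2 / 3 : ℝ) ∂P
            ≤ C * MetaStorm.rate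
                (C₁ * MetaStorm.orderW₁
                  (MetaStorm.objective D f x₁ - ⨅ x, MetaStorm.objective D f x) σ G β)
                (C₂ * MetaStorm.orderW₂
                  (MetaStorm.objective D f x₁ - ⨅ x, MetaStorm.objective D f x) σ G β)
                (C₃ * MetaStorm.orderW₃ G β) σ T := by
  refine ⟨10 ^ 5, 2 * 10 ^ 10, 2 * 10 ^ 10, 1, by norm_num, by norm_num, by norm_num, by norm_num,
    ?_⟩
  intro d Ξ _ D _ f σ β G hσ hβ hG hf hlow hu hs hb x₁ T hT Ω _ P _ ξ τ hm hD hi hτ hτu hτi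
  -- Time `t ≥ 1` corresponds to step `t - 1` of `run` on the samples shifted by one; truncated
  -- subtraction also matches the convention at `t = 0`.
  have hiter : ∀ (z : ℕ → Ξ) (t : ℕ), MetaStorm.iterate 1 1 1 (1 / 2) f x₁ z t =
      (MetaStorm.run f x₁ (fun i => z (i + 1)) (t - 1)).x := by
    intro z t
    rw [MetaStorm.iterate]
    cases t with
    | zero => rfl
    | succ n => rw [MetaStorm.state_succ_eq_run]; rfl
  have hmg := MetaStorm.measurable_gradient_objective hβ hu hs
  have hk : ∀ t, Measurable fun z : ℕ → Ξ => ‖gradient (MetaStorm.objective D f)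
      (MetaStorm.iterate 1 1 1 (1 / 2) f x₁ z t)‖ ^ (2 / 3 : ℝ) := by
    intro t
    simp_rw [hiter]
    exact (hmg.comp (MetaStorm.measurable_x.comp (MetaStorm.measurable_run hf _
      fun i _ => measurable_pi_apply (i + 1)))).norm.pow_const _
  have hki : ∀ t, Integrable (fun ω => ‖gradient (MetaStorm.objective D f)
      (MetaStorm.iterate 1 1 1 (1 / 2) f x₁ (fun t => ξ t ω) t)‖ ^ (2 / 3 : ℝ)) P := by
    intro t
    refine Integrable.of_bound ((hk t).comp (measurable_pi_iff.2 hm)).aestronglyMeasurable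
      (G ^ (2 / 3 : ℝ)) (Filter.Eventually.of_forall fun ω => ?_)
    rw [Real.norm_of_nonneg (by positivity)]
    exact Real.rpow_le_rpow (norm_nonneg _) (MetaStorm.norm_gradient_objective_le hu hb _)
      (by norm_num)
  obtain ⟨h1, h2⟩ := MetaStorm.integral_uniform_index hτ hτu hτi hk hki
  refine ⟨h1, ?_⟩
  rw [h2]
  refine le_trans ?_ (MetaStorm.integral_sum_gradient_sq_rpow_run_le (P := P) (x₁ := x₁)
    (ζ := fun i => ξ (i + 1)) hσ hβ hG hf hlow hu hs hb (fun i => hm _) (fun i => hD _)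
    (hi.precomp (add_left_injective 1)) hT)
  have hIcc : Finset.Icc 1 T = Finset.Ico 1 (T + 1) := by ext; simp
  rw [hIcc, Finset.sum_Ico_eq_sum_range, Nat.add_sub_cancel, ← integral_div]
  simp_rw [← integral_const_mul]
  rw [← integral_finsetSum _ fun i _ => (hki (1 + i)).const_mul _]
  refine integral_mono (integrable_finsetSum _ fun i _ => (hki (1 + i)).const_mul _)
    ((MetaStorm.integrable_rpow_third (MetaStorm.integrable_sum_gradient_sq_run hβ hf hu hs hb
      (fun i => hm _) T) fun ω => Finset.sum_nonneg fun i _ => sq_nonneg _).div_const _)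
    fun ω => ?_
  simp_rw [hiter, Nat.add_sub_cancel_left]
  exact MetaStorm.mean_rpow_two_thirds_le hT fun i => norm_nonneg _
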